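/- Let $d\ge 2$ and let $\Omega\subset\mathbb R^d$ be a bounded connected domain with a finite conforming subdivision $\mathbb T_h$ of $\overline\Omega$ into nondegenerate closed simplices and parallelotopes ($\Omega$ is the interior of the union of the elements; two elements meet in a common, possibly empty, face). Let $h$ be the largest element diameter, $\Gamma_i$ the set of interior $(d-1)$-dimensional faces, each with a unit normal $\mathbf n_F$ pointing from $T_-$ to $T_+$, and put $[\phi]=\phi|_{T_-}-\phi|_{T_+}$, $\{\phi\}=\tfrac12(\phi|_{T_-}+\phi|_{T_+})$. Let $\Gamma_{pN}$ and $\Gamma_{uD}$ be sets of boundary faces, $\Gamma_{uD}\neq\emptyset$, and let $\mathbf n$ be the exterior unit normal on $\partial\Omega$. Let $\mathbf X_h\subset H^{\mathrm{div}}(\Omega)$ be a finite-dimensional space of vector fields that are polynomial on each element, let $\mathbf W_h=\{\mathbf z\in\mathbf X_h:\mathbf z\cdot\mathbf n=0\text{ on }\Gamma_{pN}\}$ and $\mathbf V_h=\{\mathbf v\in\mathbf X_h:\mathbf v\cdot\mathbf n=0\text{ on }\Gamma_{uD}\}$, and let $Q_h$ be a space of piecewise polynomial functions with $$\operatorname{div}\mathbf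 W_h=Q_h=\operatorname{div}\mathbf V_h .$$ With $\epsilon(\mathbf u)=\frac12(\nabla\mathbf u+(\nabla\mathbf u)^T)$ and a parameter $\gamma>0$ let $$\begin{aligned} d_h(\mathbf u,\mathbf v)={}&2(\epsilon(\mathbf u),\epsilon(\mathbf v))_{\mathbb T_h}+\tfrac{\gamma}{h}([\mathbf u],[\mathbf v])_{\Gamma_i}-2(\{\epsilon(\mathbf u)\mathbf n_F\},[\mathbf v])_{\Gamma_i}-2(\{\epsilon(\mathbf v)\mathbf n_F\},[\mathbf u])_{\Gamma_i}\\&+\tfrac{\gamma}{h}(\mathbf u,\mathbf v)_{\Gamma_{uD}}-2(\epsilon(\mathbf u)\mathbf n,\mathbf v)_{\Gamma_{uD}}-2(\epsilon(\mathbf v)\mathbf n,\mathbf u)_{\Gamma_{uD}},\\ a_h(\mathbf u,\mathbf v)={}&\mu\, d_h(\mathbf u,\mathbf v)+\lambda(\operatorname{div}\mathbf u,\operatorname{div}\mathbf v)_\Omega ,\end{aligned}$$ where $(\cdot,\cdot)$ with an index denotes the $L^2$ inner product on $\Omega$, respectively the sum of the $L^2$ inner products over the elements or faces. Call $\gamma$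 *admissible* if $d_h$ is coercive on $\mathbf V_h$: there is $\kappa>0$ with $\kappa\|\mathbf v\|_{1,h}^2\le d_h(\mathbf v,\mathbf v)$ for all $\mathbf v\in\mathbf V_h$, where $\|\mathbf v\|_{1,h}^2=\sum_{T\in\mathbb T_h}\|\nabla\mathbf v\|_T^2+\sum_{F\in\Gamma_i}\frac\gamma h\|[\mathbf v]\|_F^2+\sum_{F\in\Gamma_{uD}}\frac\gamma h\|\mathbf v\|_F^2$. Then: 1. All sufficiently large $\gamma$ are admissible, with a threshold that depends only on the mesh, $\Gamma_{uD}$ and the discrete spaces. 2. Let $\gamma>0$ be admissible, $\mu>0$, $\lambda\ge0$, $c_s\ge0$ (including $c_s=0$), $\alpha\in\mathbb R$, and let $K\in\mathbb R^{d\times d}$ be symmetric positive definite. For every $\sigma>0$ the system $$\begin{aligned}(\sigma(c_sp_h+\alpha\operatorname{div}\mathbf u_h),q)_\Omega+(\operatorname{div}\mathbf w_h,q)_\Omega&=0&&\forall q\in Q_h,\\ (K^{-1}\mathbf w_h,\mathbf z)_\Omega-(p_h,\operatorname{div}\mathbf z)_\Omega&=0&&\forall\mathbf z\in\mathbf W_h,\\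 a_h(\mathbf u_h,\mathbf v)-\alpha(p_h,\operatorname{div}\mathbf v)_\Omega&=0&&\forall\mathbf v\in\mathbf V_h\end{aligned}$$ has in $Q_h\times\mathbf W_h\times\mathbf V_h$ exactly one solution, $(p_h,\mathbf w_h,\mathbf u_h)=\mathbf 0$. 3. If moreover $\alpha\ne0$ or $c_s>0$, the semi-discrete scheme is uniquely solvable: for all time-dependent linear functionals $F(t)$ on $Q_h$, $G(t)$ on $\mathbf W_h$ (continuous in $t\ge0$) and $R(t)$ on $\mathbf V_h$ (continuously differentiable in $t\ge0$) and all $p^0\in Q_h$, $\mathbf u^0\in\mathbf V_h$ with $a_h(\mathbf u^0,\mathbf v)-\alpha(p^0,\operatorname{div}\mathbf v)_\Omega=R(0)(\mathbf v)$ for all $\mathbf v\in\mathbf V_h$, there is exactly one triple of continuous functions $(p_h,\mathbf w_h,\mathbf u_h):[0,\infty)\to Q_h\times\mathbf W_h\times\mathbf V_h$ such that $p_h(0)=p^0$, $\mathbf u_h(0)=\mathbf u^0$ and, for all $t>0$, $$\begin{aligned}\tfrac{d}{dt}(c_sp_h+\alpha\operatorname{div}\mathbf u_h,q)_\Omega+(\operatorname{div}\mathbf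 w_h,q)_\Omega&=F(t)(q)&&\forall q\in Q_h,\\ (K^{-1}\mathbf w_h,\mathbf z)_\Omega-(p_h,\operatorname{div}\mathbf z)_\Omega&=G(t)(\mathbf z)&&\forall\mathbf z\in\mathbf W_h,\\ a_h(\mathbf u_h,\mathbf v)-\alpha(p_h,\operatorname{div}\mathbf v)_\Omega&=R(t)(\mathbf v)&&\forall\mathbf v\in\mathbf V_h,\end{aligned}$$ where the derivative is required to exist. -/

import Mathlib

namespace Biot

noncomputable section

/-- The space `ℝᵈ` with its Euclidean norm. -/
abbrev E (d : ℕ) := EuclideanSpace ℝ (Fin d)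

/-! ### Meshes -/

/-- A nondegenerate closed `d`-simplex in `ℝᵈ`. -/
def IsSimplex {d : ℕ} (T : Set (E d)) : Prop :=
  ∃ p : Fin (d + 1) → E d, AffineIndependent ℝ p ∧ T = convexHull ℝ (Set.range p)

/-- A nondegenerate closed parallelotope in `ℝᵈ` (a parallelogram for `d = 2`, a parallelepiped
for `d = 3`). -/
def IsParallelotope {d : ℕ} (T : Set (E d)) : Prop :=
  ∃ (a : E d) (b : Fin d → E d), LinearIndependent ℝ b ∧
    T = (fun x => a + x) '' parallelepiped b

/-- `F` is a face of codimension one of the convex polytope `T`. -/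
def IsFacet {d : ℕ} (T F : Set (E d)) : Prop :=
  F.Nonempty ∧ IsExposed ℝ T F ∧ Module.finrank ℝ (vectorSpan ℝ F) + 1 = d

/-- `n` is the unit normal to the face `F` of `T` that points out of `T`: the face is the set of
points of `T` that are extremal in direction `n`. -/
def IsOuterNormal {d : ℕ} (T F : Set (E d)) (n : E d) : Prop :=
  ‖n‖ = 1 ∧ F = {x ∈ T | ∀ y ∈ T, inner ℝ n y ≤ inner ℝ n x}

/-- A conforming mesh of simplices and parallelotopes. The elements are indexed by `ι`, the interior
faces by `I` and the boundary faces by `B`. Every interior face carries a unit normal, which points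
from the element `minus` to the element `plus`; every boundary face carries the exterior
unit normal. -/
structure Mesh (d : ℕ) (ι I B : Type*) where
  /-- the (closed) mesh elements -/
  elem : ι → Set (E d)
  elem_injective : Function.Injective elem
  shape : ∀ T, IsSimplex (elem T) ∨ IsParallelotope (elem T)
  /-- any two elements meet in a common (possibly empty) face; the condition for the pair `(S, T)`
  says that the intersection is also a face of the other element -/
  conforming : ∀ T S, IsExposed ℝ (elem T) (elem T ∩ elem S)
  /-- the interior faces: faces shared by two elements -/
  iface : I → Set (E d)
  iface_injective : Function.Injective iface
  range_iface : Set.range iface =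
    {F | ∃ T S, T ≠ S ∧ IsFacet (elem T) F ∧ IsFacet (elem S) F}
  minus : I → ι
  plus : I → ι
  minus_ne_plus : ∀ F, minus F ≠ plus F
  facet_minus : ∀ F, IsFacet (elem (minus F)) (iface F)
  facet_plus : ∀ F, IsFacet (elem (plus F)) (iface F)
  inormal : I → E d
  inormal_outer : ∀ F, IsOuterNormal (elem (minus F)) (iface F) (inormal F)
  /-- the boundary faces: faces of elements that lie on the boundary of the domain -/
  bface : B → Set (E d)
  bface_injective : Function.Injective bface
  range_bface : Set.range bface =
    {F | (∃ T, IsFacet (elem T) F) ∧ F ⊆ frontier (interior (⋃ T, elem T))}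
  /-- the element to which a boundary face belongs -/
  owner : B → ι
  facet_owner : ∀ F, IsFacet (elem (owner F)) (bface F)
  bnormal : B → E d
  bnormal_outer : ∀ F, IsOuterNormal (elem (owner F)) (bface F) (bnormal F)

/-! ### Piecewise polynomial functions

A piecewise polynomial function is stored through the polynomials that represent it on the
elements; since elements have nonempty interior, these are determined by the function. -/

/-- Piecewise polynomial scalar functions (no continuity between elements). -/
abbrev Scal (d : ℕ) (ι : Type*) := ι → MvPolynomial (Fin d) ℝ

/-- Piecewise polynomial vector fields (no continuity between elements). -/
abbrev Vect (d : ℕ) (ι : Type*) := ι → Fin d → MvPolynomial (Fin d) ℝ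

/-- The value of a polynomial at a point of `ℝᵈ`. -/
def val {d : ℕ} (f : MvPolynomial (Fin d) ℝ) (x : E d) : ℝ := MvPolynomial.eval (fun j => x j) f

/-- The elementwise divergence. -/
def divB (d : ℕ) (ι : Type*) : Vect d ι →ₗ[ℝ] Scal d ι where
  toFun v := fun T => ∑ j, MvPolynomial.pderiv j (v T j)
  map_add' u v := by
    funext T
    simp [Finset.sum_add_distrib]
  map_smul' c v := by
    funext T
    simp [Finset.smul_sum]

/-- The entry `∂ⱼ vᵢ` of the gradient of a polynomial vector field. -/
def grad {d : ℕ} (v : Fin d → MvPolynomial (Fin d) ℝ) (i j : Fin d) (x : E d) : ℝ :=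
  val (MvPolynomial.pderiv j (v i)) x

/-- The entry `i j` of the strain `ε(v) = (∇v + (∇v)ᵀ) / 2` of a polynomial vector field. -/
def strain {d : ℕ} (v : Fin d → MvPolynomial (Fin d) ℝ) (i j : Fin d) (x : E d) : ℝ :=
  (grad v i j x + grad v j i x) / 2

/-- The component `i` of `ε(v) n`. -/
def strainN {d : ℕ} (v : Fin d → MvPolynomial (Fin d) ℝ) (n : E d) (i : Fin d) (x : E d) : ℝ :=
  ∑ j, strain v i j x * n j

namespace Mesh

variable {d : ℕ} {ι I B : Type*}

/-- The domain `Ω` that is subdivided by the mesh. -/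
def domain (M : Mesh d ι I B) : Set (E d) := interior (⋃ T, M.elem T)

/-- The mesh size: the largest diameter of an element. -/
def size (M : Mesh d ι I B) : ℝ := ⨆ T, Metric.diam (M.elem T)

/-- The integral over a face with respect to the surface measure. -/
def faceInt (F : Set (E d)) (f : E d → ℝ) : ℝ :=
  ∫ x in F, f x ∂(MeasureTheory.Measure.euclideanHausdorffMeasure (d - 1))

/-- The jump of the component `i` of `v` across an interior face. -/
def jump (M : Mesh d ι I B) (v : Vect d ι) (F : I) (i : Fin d) (x : E d) : ℝ :=
  val (v (M.minus F) i) x - val (v (M.plus F) i) x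

/-- The average of the component `i` of `ε(v) n_F` on an interior face. -/
def avgStrainN (M : Mesh d ι I B) (v : Vect d ι) (F : I) (i : Fin d) (x : E d) : ℝ :=
  (strainN (v (M.minus F)) (M.inormal F) i x + strainN (v (M.plus F)) (M.inormal F) i x) / 2

section Forms

variable [Fintype ι]

/-- The `L²(Ω)` inner product of scalar functions. -/
def innerS (M : Mesh d ι I B) (p q : Scal d ι) : ℝ :=
  ∑ T, ∫ x in M.elem T, val (p T) x * val (q T) x

/-- `(A w, z)_Ω` for a matrix `A`. -/
def innerV (M : Mesh d ι I B) (A : Matrix (Fin d) (Fin d) ℝ) (w z : Vect d ι) : ℝ :=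
  ∑ T, ∫ x in M.elem T, ∑ i, (∑ j, A i j * val (w T j) x) * val (z T i) x

/-- `v ∈ H^div(Ω)`: the distributional divergence of `v` on `Ω` is the square integrable function
given by the elementwise divergence. (If the distributional divergence is any `L²` function at all,
it is this one, as one sees from test functions supported in the interior of an element.) -/
def IsHdiv (M : Mesh d ι I B) (v : Vect d ι) : Prop :=
  ∀ φ : E d → ℝ, ContDiff ℝ (⊤ : ℕ∞) φ → HasCompactSupport φ → tsupport φ ⊆ M.domain →
    ∑ T, ∫ x in M.elem T, ∑ i, val (v T i) x * fderiv ℝ φ x (EuclideanSpace.single i 1) =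
      -∑ T, ∫ x in M.elem T, val (divB d ι v T) x * φ x

variable [Fintype I]

/-- The symmetric interior penalty form `d_h` for `-2 div ε(u)`, with Dirichlet faces `Γ`. -/
def dForm (M : Mesh d ι I B) (Γ : Finset B) (γ : ℝ) (u v : Vect d ι) : ℝ :=
  2 * (∑ T, ∫ x in M.elem T, ∑ i, ∑ j, strain (u T) i j x * strain (v T) i j x)
  + γ / M.size * (∑ F, faceInt (M.iface F) fun x => ∑ i, M.jump u F i x * M.jump v F i x)
  - 2 * (∑ F, faceInt (M.iface F) fun x => ∑ i, M.avgStrainN u F i x * M.jump v F i x)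
  - 2 * (∑ F, faceInt (M.iface F) fun x => ∑ i, M.avgStrainN v F i x * M.jump u F i x)
  + γ / M.size * (∑ F ∈ Γ, faceInt (M.bface F) fun x =>
      ∑ i, val (u (M.owner F) i) x * val (v (M.owner F) i) x)
  - 2 * (∑ F ∈ Γ, faceInt (M.bface F) fun x =>
      ∑ i, strainN (u (M.owner F)) (M.bnormal F) i x * val (v (M.owner F) i) x)
  - 2 * (∑ F ∈ Γ, faceInt (M.bface F) fun x =>
      ∑ i, strainN (v (M.owner F)) (M.bnormal F) i x * val (u (M.owner F) i) x)

/-- The square of the mesh dependent norm `‖v‖_{1,h}`. -/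
def normSq (M : Mesh d ι I B) (Γ : Finset B) (γ : ℝ) (v : Vect d ι) : ℝ :=
  (∑ T, ∫ x in M.elem T, ∑ i, ∑ j, grad (v T) i j x ^ 2)
  + (∑ F, γ / M.size * faceInt (M.iface F) fun x => ∑ i, M.jump v F i x ^ 2)
  + (∑ F ∈ Γ, γ / M.size * faceInt (M.bface F) fun x => ∑ i, val (v (M.owner F) i) x ^ 2)

/-- Coercivity of `d_h` on the space `V`, for the penalty parameter `γ`. -/
def Coercive (M : Mesh d ι I B) (Γ : Finset B) (γ : ℝ) (V : Submodule ℝ (Vect d ι)) : Prop :=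
  ∃ κ : ℝ, 0 < κ ∧ ∀ v ∈ V, κ * M.normSq Γ γ v ≤ M.dForm Γ γ v v

end Forms

/-- The piecewise polynomial vector fields whose normal component vanishes on the boundary
faces in `Γ`. -/
def normalZero (M : Mesh d ι I B) (Γ : Finset B) : Submodule ℝ (Vect d ι) where
  carrier := {v | ∀ F ∈ Γ, ∀ x ∈ M.bface F, ∑ i, val (v (M.owner F) i) x * M.bnormal F i = 0}
  zero_mem' := by
    intro F _ x _
    simp [val]
  add_mem' := by
    intro u v hu hv F hF x hx
    have h₁ := hu F hF x hx
    have h₂ := hv F hF x hx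
    simp only [val, Pi.add_apply, map_add, add_mul, Finset.sum_add_distrib] at h₁ h₂ ⊢
    rw [h₁, h₂, add_zero]
  smul_mem' := by
    intro c v hv F hF x hx
    have h := hv F hF x hx
    simp only [val, Pi.smul_apply, MvPolynomial.smul_eval, mul_assoc, ← Finset.mul_sum] at h ⊢
    rw [h, mul_zero]

end Mesh

/-! ### The discrete Biot system -/

/-- The coefficients of the Biot system: the Lamé parameters, the Biot-Willis constant, the
constrained specific storage coefficient and the permeability. -/
structure Coefficients (d : ℕ) where
  mu : ℝ
  lam : ℝ
  alpha : ℝ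
  cs : ℝ
  K : Matrix (Fin d) (Fin d) ℝ

namespace Mesh

variable {d : ℕ} {ι I B : Type*} [Fintype ι] [Fintype I]

/-- The form `a_h` of linear elasticity. -/
def aForm (M : Mesh d ι I B) (Γ : Finset B) (γ : ℝ) (c : Coefficients d) (u v : Vect d ι) : ℝ :=
  c.mu * M.dForm Γ γ u v + c.lam * M.innerS (divB d ι u) (divB d ι v)

/-- `(p, w, u)` solves the homogeneous system with parameter `σ` in `Q × W × V`. -/
structure IsHomogeneousSolution (M : Mesh d ι I B) (Γ : Finset B) (γ : ℝ) (c : Coefficients d)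
    (Q : Submodule ℝ (Scal d ι)) (W V : Submodule ℝ (Vect d ι)) (σ : ℝ)
    (p : Q) (w : W) (u : V) : Prop where
  mass : ∀ q ∈ Q, M.innerS (σ • (c.cs • (p : Scal d ι) + c.alpha • divB d ι u)) q
    + M.innerS (divB d ι w) q = 0
  darcy : ∀ z ∈ W, M.innerV c.K⁻¹ w z - M.innerS p (divB d ι z) = 0
  elasticity : ∀ v ∈ V, M.aForm Γ γ c u v - c.alpha * M.innerS p (divB d ι v) = 0

/-- `(p, w, u)` solves the semi-discrete scheme on `[0, ∞)` with values in `Q × W × V`; the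
time-dependent right hand sides of the three equations are linear functionals of the test
functions. Continuity of a curve in a finite dimensional space is expressed by that of all its
linear coordinates. -/
structure IsSemidiscreteSolution (M : Mesh d ι I B) (Γ : Finset B) (γ : ℝ) (c : Coefficients d)
    (Q : Submodule ℝ (Scal d ι)) (W V : Submodule ℝ (Vect d ι))
    (f : ℝ → Module.Dual ℝ Q) (g : ℝ → Module.Dual ℝ W) (r : ℝ → Module.Dual ℝ V)
    (p : ℝ → Q) (w : ℝ → W) (u : ℝ → V) : Prop where
  continuous_p : ∀ l : Module.Dual ℝ Q, ContinuousOn (fun t => l (p t)) (Set.Ici 0)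
  continuous_w : ∀ l : Module.Dual ℝ W, ContinuousOn (fun t => l (w t)) (Set.Ici 0)
  continuous_u : ∀ l : Module.Dual ℝ V, ContinuousOn (fun t => l (u t)) (Set.Ici 0)
  /-- `(∂ₜ (c_s p + α div u), q) + (div w, q) = f(q)` -/
  mass : ∀ t > 0, ∀ q : Q,
    HasDerivAt (fun s => M.innerS (c.cs • (p s : Scal d ι) + c.alpha • divB d ι (u s)) q)
      (f t q - M.innerS (divB d ι (w t)) q) t
  darcy : ∀ t > 0, ∀ z : W,
    M.innerV c.K⁻¹ (w t) z - M.innerS (p t) (divB d ι z) = g t z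
  elasticity : ∀ t > 0, ∀ v : V,
    M.aForm Γ γ c (u t) v - c.alpha * M.innerS (p t) (divB d ι v) = r t v

/-- Unique solvability of initial value problems for the semi-discrete scheme: for all right hand
sides (`f`, `g` continuous and `r` continuously differentiable in time) and all initial values that
are compatible with the elasticity equation at time zero, there is exactly one solution. -/
def IsWellPosed (M : Mesh d ι I B) (Γ : Finset B) (γ : ℝ) (c : Coefficients d)
    (Q : Submodule ℝ (Scal d ι)) (W V : Submodule ℝ (Vect d ι)) : Prop :=
  ∀ (f : ℝ → Module.Dual ℝ Q) (g : ℝ → Module.Dual ℝ W) (r : ℝ → Module.Dual ℝ V),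
    (∀ q, ContinuousOn (fun t => f t q) (Set.Ici 0)) →
    (∀ z, ContinuousOn (fun t => g t z) (Set.Ici 0)) →
    (∀ v, ContDiffOn ℝ 1 (fun t => r t v) (Set.Ici 0)) →
    ∀ (p₀ : Q) (u₀ : V),
      (∀ v : V, M.aForm Γ γ c u₀ v - c.alpha * M.innerS p₀ (divB d ι v) = r 0 v) →
      ∃ (p : ℝ → Q) (w : ℝ → W) (u : ℝ → V),
        (M.IsSemidiscreteSolution Γ γ c Q W V f g r p w u ∧ p 0 = p₀ ∧ u 0 = u₀) ∧
        ∀ (p' : ℝ → Q) (w' : ℝ → W) (u' : ℝ → V),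
          M.IsSemidiscreteSolution Γ γ c Q W V f g r p' w' u' → p' 0 = p₀ → u' 0 = u₀ →
          ∀ t ≥ 0, p' t = p t ∧ w' t = w t ∧ u' t = u t

end Mesh

end

end Biot

/-!
Testing the three equations with `p`, `w` and `u` yields an energy identity in which every term is
nonnegative, so that `w = 0` and `u = 0`, and then `p = 0` because every function in `Q` is a
divergence. For the semi-discrete scheme one solves the second equation for `w` and the third for
`u`, in terms of `p`. The fluid content `η = c_s p + α div u` then determines `p`: by the coercivity
of the elasticity form and, when `c_s = 0`, the surjectivity of the divergence, it depends on `p`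
through a positive definite form. What remains is a linear differential equation with constant
coefficients for `η`.

Coercivity of the interior penalty form rests on the fact that on a finite dimensional space a
positive semidefinite form is bounded by a multiple of any other whose kernel is contained in its
own. This gives a discrete trace inequality, which absorbs the consistency terms, and a discrete
Korn inequality. For the latter one has to see that a piecewise rigid motion without jumps that
vanishes on a boundary face is zero. A rigid motion that vanishes on a piece of a hyperplane
vanishes, which carries the value zero from an element to its neighbours; and all the elements are
reached through interior faces, since a connected open set remains connected when finitely many
affine subspaces of codimension at least two are removed.
-/
namespace Biot

open Module Set Filter Topology

/-! ### Convex bodies and their faces -/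

section Modules

variable {V : Type*} [AddCommGroup V] [Module ℝ V]

theorem vectorSpan_le_ker_iff {V' : Type*} [AddCommGroup V'] [Module ℝ V'] {F : Set V}
    {l : V →ₗ[ℝ] V'} :
    vectorSpan ℝ F ≤ LinearMap.ker l ↔ ∀ x ∈ F, ∀ y ∈ F, l x = l y := by
  rw [vectorSpan_def, Submodule.span_le]
  constructor
  · intro h x hx y hy
    simpa [sub_eq_zero] using h (vsub_mem_vsub hx hy)
  · rintro h _ ⟨x, hx, y, hy, rfl⟩
    simp [h x hx y hy]

theorem exists_dual_ker_eq [FiniteDimensional ℝ V] {W : Submodule ℝ V}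
    (hW : finrank ℝ W + 1 = finrank ℝ V) : ∃ l : Dual ℝ V, LinearMap.ker l = W := by
  have hlt : W < ⊤ := lt_top_iff_ne_top.2 fun h => by
    rw [h, finrank_top] at hW
    omega
  obtain ⟨l, hl, hWl⟩ := W.exists_le_ker_of_lt_top hlt
  refine ⟨l, (Submodule.eq_of_le_of_finrank_eq hWl ?_).symm⟩
  have := Module.Dual.finrank_ker_add_one_of_ne_zero hl
  omega

end Modules

section ConvexBodies

variable {V : Type*} [NormedAddCommGroup V] [NormedSpace ℝ V]

/-- A convex body: a compact convex set with nonempty interior. -/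
structure IsBody (T : Set V) : Prop where
  isCompact : IsCompact T
  convex : Convex ℝ T
  nonempty_interior : (interior T).Nonempty

theorem IsBody.subset_closure_interior {T : Set V} (hT : IsBody T) : T ⊆ closure (interior T) := by
  rw [hT.convex.closure_interior_eq_closure_of_nonempty_interior hT.nonempty_interior]
  exact subset_closure

theorem IsBody.vectorSpan_eq_top {T : Set V} (hT : IsBody T) : vectorSpan ℝ T = ⊤ := by
  have h : affineSpan ℝ T = ⊤ := top_unique <|
    (isOpen_interior.affineSpan_eq_top hT.nonempty_interior).ge.trans
      (affineSpan_mono ℝ interior_subset)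
  rw [← direction_affineSpan, h, AffineSubspace.direction_top]

theorem IsBody.diam_pos [Nontrivial V] {T : Set V} (hT : IsBody T) : 0 < Metric.diam T := by
  obtain ⟨x, hx⟩ := hT.nonempty_interior
  have := Module.punctured_nhds_neBot ℝ V x
  exact Metric.diam_pos (infinite_of_mem_nhds x (mem_interior_iff_mem_nhds.1 hx)).nontrivial
    hT.isCompact.isBounded

/-- The affine span of `F`, parametrized isometrically by `vectorSpan ℝ F` with origin `x₀ ∈ F`. -/
noncomputable def spanChart (F : Set V) (x₀ : V) : vectorSpan ℝ F →ᵃⁱ[ℝ] V :=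
  (AffineIsometryEquiv.constVAdd ℝ V x₀).toAffineIsometry.comp
    (vectorSpan ℝ F).subtypeₗᵢ.toAffineIsometry

theorem spanChart_apply (F : Set V) (x₀ : V) (w : vectorSpan ℝ F) :
    spanChart F x₀ w = x₀ + w := rfl

theorem image_preimage_spanChart {F : Set V} {x₀ : V} (hx₀ : x₀ ∈ F) :
    spanChart F x₀ '' (spanChart F x₀ ⁻¹' F) = F :=
  image_preimage_eq_iff.2 fun x hx =>
    ⟨⟨x - x₀, vsub_mem_vectorSpan ℝ hx hx₀⟩, by simp [spanChart_apply]⟩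

theorem isBody_preimage_spanChart [FiniteDimensional ℝ V] {F : Set V} (hc : IsCompact F)
    (hF : Convex ℝ F) {x₀ : V} (hx₀ : x₀ ∈ F) : IsBody (spanChart F x₀ ⁻¹' F) := by
  have hconv : Convex ℝ (spanChart F x₀ ⁻¹' F) := hF.affine_preimage (spanChart F x₀).toAffineMap
  have hspan : (vectorSpan ℝ (spanChart F x₀ ⁻¹' F)).map (vectorSpan ℝ F).subtype
      = vectorSpan ℝ F := by
    have h := AffineMap.map_vectorSpan (spanChart F x₀).toAffineMap (s := spanChart F x₀ ⁻¹' F)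
    rwa [AffineIsometry.coe_toAffineMap, image_preimage_spanChart hx₀] at h
  refine ⟨(spanChart F x₀).isometry.isEmbedding.isInducing.isCompact_iff.2 ?_, hconv, ?_⟩
  · rwa [image_preimage_spanChart hx₀]
  · rw [hconv.interior_nonempty_iff_affineSpan_eq_top,
      AffineSubspace.affineSpan_eq_top_iff_vectorSpan_eq_top_of_nonempty ℝ _ _
        ⟨0, by simpa [spanChart_apply] using hx₀⟩]
    refine Submodule.map_injective_of_injective (vectorSpan ℝ F).injective_subtype ?_
    rw [hspan, Submodule.map_top, Submodule.range_subtype]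

theorem eq_of_isExposed_of_vectorSpan_eq_top {T F : Set V} (h : IsExposed ℝ T F)
    (hne : F.Nonempty) (htop : vectorSpan ℝ F = ⊤) : F = T := by
  obtain ⟨l, rfl⟩ := h hne
  have hker : vectorSpan ℝ {x ∈ T | ∀ y ∈ T, l y ≤ l x} ≤ LinearMap.ker (l : V →ₗ[ℝ] ℝ) :=
    vectorSpan_le_ker_iff.2 fun x hx y hy => le_antisymm (hy.2 x hx.1) (hx.2 y hy.1)
  have hl : ∀ x, l x = 0 := fun x => hker (htop ▸ Submodule.mem_top)
  simp [hl]

end ConvexBodies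

/-! ### Feasible directions -/

section FeasibleDirections

variable {V : Type*} [AddCommGroup V] [Module ℝ V] {S T : Set V} {x v w : V}

/-- `v` is a feasible direction of `S` at `x`: a short segment from `x` in direction `v` stays
in `S`. -/
def IsFeasibleDirection (S : Set V) (x v : V) : Prop := ∀ᶠ δ in 𝓝[>] (0 : ℝ), x + δ • v ∈ S

namespace IsFeasibleDirection

theorem mono (hST : S ⊆ T) (h : IsFeasibleDirection S x v) : IsFeasibleDirection T x v :=
  Eventually.mono h fun _ hδ => hST hδ

theorem inter (hS : IsFeasibleDirection S x v) (hT : IsFeasibleDirection T x v) :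
    IsFeasibleDirection (S ∩ T) x v :=
  Eventually.and hS hT

theorem mem_vectorSpan (h : IsFeasibleDirection S x v) (hx : x ∈ S) : v ∈ vectorSpan ℝ S := by
  obtain ⟨δ, hδS, hδ⟩ := (Eventually.and h self_mem_nhdsWithin).exists
  have h' := (vectorSpan ℝ S).smul_mem δ⁻¹ (vsub_mem_vectorSpan ℝ hδS hx)
  rwa [vsub_eq_sub, add_sub_cancel_left, inv_smul_smul₀ (ne_of_gt hδ)] at h'

theorem smul (h : IsFeasibleDirection S x v) {c : ℝ} (hc : 0 < c) :
    IsFeasibleDirection S x (c • v) := by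
  have hlim : Tendsto (fun δ : ℝ => δ * c) (𝓝[>] 0) (𝓝[>] 0) :=
    tendsto_nhdsWithin_iff.2
      ⟨tendsto_nhdsWithin_of_tendsto_nhds (by simpa using (continuous_mul_const c).tendsto 0),
        eventually_mem_nhdsWithin.mono fun δ hδ => mul_pos hδ hc⟩
  exact (hlim.eventually h).mono fun δ hδ => by rwa [smul_smul]

theorem add (hS : Convex ℝ S) (hv : IsFeasibleDirection S x v) (hw : IsFeasibleDirection S x w) :
    IsFeasibleDirection S x (v + w) := by
  filter_upwards [hv.smul two_pos, hw.smul two_pos] with δ h₁ h₂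
  convert hS h₁ h₂ (a := 1 / 2) (b := 1 / 2) (by norm_num) (by norm_num) (by norm_num) using 1
  module

theorem of_mem (hS : Convex ℝ S) (hx : x ∈ S) {y : V} (hy : y ∈ S) :
    IsFeasibleDirection S x (y - x) := by
  filter_upwards [Ioo_mem_nhdsGT zero_lt_one] with δ hδ
  exact hS.add_smul_sub_mem hx hy ⟨hδ.1.le, hδ.2.le⟩

theorem of_pos (hS : Convex ℝ S) (hx : x ∈ S) {l : Dual ℝ V}
    (hl : ∀ w ∈ LinearMap.ker l, IsFeasibleDirection S x w) {y : V} (hy : y ∈ S)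
    (hly : 0 < l (y - x)) (hv : 0 < l v) : IsFeasibleDirection S x v := by
  have hker : v - (l v / l (y - x)) • (y - x) ∈ LinearMap.ker l := by
    rw [LinearMap.mem_ker, map_sub l v, map_smul, smul_eq_mul, div_mul_cancel₀ _ hly.ne', sub_self]
  simpa using (hl _ hker).add hS ((of_mem hS hx hy).smul (div_pos hv hly))

end IsFeasibleDirection

theorem vectorSpan_inter_eq_top_of_same_side (hS : Convex ℝ S) (hT : Convex ℝ T)
    (hxS : x ∈ S) (hxT : x ∈ T) {l : Dual ℝ V}
    (hlS : ∀ w ∈ LinearMap.ker l, IsFeasibleDirection S x w)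
    (hlT : ∀ w ∈ LinearMap.ker l, IsFeasibleDirection T x w)
    {y z : V} (hy : y ∈ S) (hz : z ∈ T) (hyz : 0 < l (y - x) * l (z - x)) :
    vectorSpan ℝ (S ∩ T) = ⊤ := by
  wlog hpos : 0 < l (y - x) generalizing l
  · refine this (l := -l) (by simpa using hlS) (by simpa using hlT)
      (by simpa only [LinearMap.neg_apply, neg_mul_neg] using hyz) ?_
    rcases pos_and_pos_or_neg_and_neg_of_mul_pos hyz with h | h
    · exact absurd h.1 hpos
    · exact neg_pos.2 h.1
  have hz' : 0 < l (z - x) := (pos_iff_pos_of_mul_pos hyz).1 hpos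
  have hmem : ∀ v, 0 < l v → v ∈ vectorSpan ℝ (S ∩ T) := fun v hv =>
    ((IsFeasibleDirection.of_pos hS hxS hlS hy hpos hv).inter
      (IsFeasibleDirection.of_pos hT hxT hlT hz hz' hv)).mem_vectorSpan ⟨hxS, hxT⟩
  refine top_unique fun v _ => ?_
  rcases lt_trichotomy (l v) 0 with h | h | h
  · exact neg_mem_iff.1 (hmem (-v) (by simpa using h))
  · exact ((hlS v h).inter (hlT v h)).mem_vectorSpan ⟨hxS, hxT⟩
  · exact hmem v h

end FeasibleDirections

theorem isFeasibleDirection_of_mem_intrinsicInterior {V : Type*} [NormedAddCommGroup V]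
    [NormedSpace ℝ V] {F : Set V} {x v : V} (hx : x ∈ intrinsicInterior ℝ F)
    (hv : v ∈ vectorSpan ℝ F) : IsFeasibleDirection F x v := by
  obtain ⟨x, hx, rfl⟩ := hx
  have hmem : ∀ δ : ℝ, x + δ • v ∈ affineSpan ℝ F := fun δ => by
    rw [add_comm]
    exact AffineSubspace.vadd_mem_of_mem_direction
      (direction_affineSpan ℝ F ▸ (vectorSpan ℝ F).smul_mem δ hv) x.2
  have hcont : Continuous fun δ : ℝ => (⟨x + δ • v, hmem δ⟩ : affineSpan ℝ F) := by fun_prop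
  have hnhds : ((↑) ⁻¹' F : Set (affineSpan ℝ F)) ∈ 𝓝 ⟨x + (0 : ℝ) • v, hmem 0⟩ := by
    simpa using mem_interior_iff_mem_nhds.1 hx
  exact nhdsWithin_le_nhds (hcont.continuousAt hnhds)

end Biot

namespace Biot

open Module Set Filter Topology

/-! ### Mesh elements and their faces -/

section Elements

variable {d : ℕ} {T F : Set (E d)}

theorem IsSimplex.isBody (hT : IsSimplex T) : IsBody T := by
  obtain ⟨p, hp, rfl⟩ := hT
  refine ⟨(finite_range p).isCompact_convexHull ℝ, convex_convexHull ℝ _, ?_⟩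
  rw [interior_convexHull_nonempty_iff_affineSpan_eq_top,
    hp.affineSpan_eq_top_iff_card_eq_finrank_add_one]
  simp

theorem IsParallelotope.isBody (hT : IsParallelotope T) : IsBody T := by
  obtain ⟨a, b, hb, rfl⟩ := hT
  let b' := Basis.mk hb (hb.span_eq_top_of_card_eq_finrank' (by simp)).ge
  have hb' : parallelepiped b = b'.parallelepiped := by simp [b']
  refine ⟨?_, (convex_parallelepiped b).translate a, ?_⟩
  · rw [hb']
    exact b'.parallelepiped.isCompact.image (by fun_prop)
  · have h : interior ((fun x => a + x) '' parallelepiped b)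
        = (fun x => a + x) '' interior (parallelepiped b) :=
      ((Homeomorph.addLeft a).image_interior _).symm
    rw [h, hb']
    exact b'.parallelepiped.interior_nonempty.image _

theorem IsFacet.subset (hF : IsFacet T F) : F ⊆ T := hF.2.1.subset

theorem IsFacet.isCompact (hF : IsFacet T F) (hT : IsBody T) : IsCompact F :=
  hF.2.1.isCompact hT.isCompact

theorem IsFacet.convex (hF : IsFacet T F) (hT : IsBody T) : Convex ℝ F :=
  hF.2.1.convex hT.convex

theorem IsFacet.dim_pos (hF : IsFacet T F) : 0 < d := by
  have := hF.2.2
  omega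

end Elements

namespace Mesh

variable {d : ℕ} {ι I B : Type*} (M : Mesh d ι I B)

theorem isBody (T : ι) : IsBody (M.elem T) :=
  (M.shape T).elim IsSimplex.isBody IsParallelotope.isBody

theorem interior_elem_subset_domain (T : ι) : interior (M.elem T) ⊆ M.domain :=
  interior_mono (subset_iUnion M.elem T)

theorem size_pos [Finite ι] [NeZero d] (T : ι) : 0 < M.size :=
  (M.isBody T).diam_pos.trans_le
    (le_ciSup (f := fun T => Metric.diam (M.elem T)) (finite_range _).bddAbove T)

variable {M}

theorem eq_of_vectorSpan_inter_eq_top {T S : ι} (hne : (M.elem T ∩ M.elem S).Nonempty)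
    (htop : vectorSpan ℝ (M.elem T ∩ M.elem S) = ⊤) : T = S := by
  refine M.elem_injective ?_
  rw [← eq_of_isExposed_of_vectorSpan_eq_top (M.conforming T S) hne htop, inter_comm]
  rw [inter_comm] at hne htop
  exact eq_of_isExposed_of_vectorSpan_eq_top (M.conforming S T) hne htop

theorem eq_of_isFacet_of_same_side {F : Set (E d)} {T S : ι} (hT : IsFacet (M.elem T) F)
    (hS : IsFacet (M.elem S) F) {x : E d} (hx : x ∈ intrinsicInterior ℝ F) {l : Dual ℝ (E d)}
    (hl : LinearMap.ker l = vectorSpan ℝ F) {y z : E d} (hy : y ∈ M.elem T) (hz : z ∈ M.elem S)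
    (hyz : 0 < l (y - x) * l (z - x)) : T = S := by
  have hxF := intrinsicInterior_subset hx
  have hfeas : ∀ w ∈ LinearMap.ker l, IsFeasibleDirection F x w := fun w hw =>
    isFeasibleDirection_of_mem_intrinsicInterior hx (hl ▸ hw)
  exact eq_of_vectorSpan_inter_eq_top ⟨x, hT.subset hxF, hS.subset hxF⟩ <|
    vectorSpan_inter_eq_top_of_same_side (M.isBody T).convex (M.isBody S).convex
      (hT.subset hxF) (hS.subset hxF) (fun w hw => (hfeas w hw).mono hT.subset)
      (fun w hw => (hfeas w hw).mono hS.subset) hy hz hyz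

theorem eq_or_eq_of_isFacet {F : Set (E d)} {T S R : ι} (hTS : T ≠ S)
    (hT : IsFacet (M.elem T) F) (hS : IsFacet (M.elem S) F) (hR : IsFacet (M.elem R) F) :
    R = T ∨ R = S := by
  obtain ⟨x, hx⟩ := hT.1.intrinsicInterior (hT.convex (M.isBody T))
  obtain ⟨l, hl⟩ := exists_dual_ker_eq (W := vectorSpan ℝ F) (by simpa using hT.2.2)
  have hside : ∀ P, IsFacet (M.elem P) F → ∃ y ∈ M.elem P, l (y - x) ≠ 0 := by
    intro P hP
    by_contra! h
    have hle : vectorSpan ℝ (M.elem P) ≤ LinearMap.ker l := vectorSpan_le_ker_iff.2 fun y hy z hz =>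
      by simpa [sub_eq_zero] using (h y hy).trans (h z hz).symm
    rw [(M.isBody P).vectorSpan_eq_top, hl, top_le_iff] at hle
    have := hP.2.2
    rw [hle, finrank_top, finrank_euclideanSpace_fin] at this
    omega
  obtain ⟨y, hy, hy0⟩ := hside T hT
  obtain ⟨z, hz, hz0⟩ := hside S hS
  obtain ⟨v, hv, hv0⟩ := hside R hR
  by_contra! hne
  have hyz := mt (eq_of_isFacet_of_same_side hT hS hx hl hy hz) hTS
  have hvy := mt (eq_of_isFacet_of_same_side hR hT hx hl hv hy) hne.1
  have hvz := mt (eq_of_isFacet_of_same_side hR hS hx hl hv hz) hne.2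
  have hsq : l (y - x) * l (z - x) * (l (v - x) * l (y - x)) * (l (v - x) * l (z - x))
      = (l (y - x) * l (z - x) * l (v - x)) ^ 2 := by ring
  have hpos : 0 < l (y - x) * l (z - x) * (l (v - x) * l (y - x)) * (l (v - x) * l (z - x)) :=
    hsq ▸ sq_pos_of_ne_zero (mul_ne_zero (mul_ne_zero hy0 hz0) hv0)
  exact hpos.not_ge <| mul_nonpos_of_nonneg_of_nonpos
    (mul_nonneg_of_nonpos_of_nonpos (not_lt.1 hyz) (not_lt.1 hvy)) (not_lt.1 hvz)

/-! ### Elements of a connected domain are connected through interior faces -/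

theorem finrank_vectorSpan_inter_le {T S : ι} (hTS : T ≠ S)
    (hne : (M.elem T ∩ M.elem S).Nonempty)
    (hF : ∀ F, IsFacet (M.elem T) (M.iface F) → ¬ IsFacet (M.elem S) (M.iface F)) :
    finrank ℝ (vectorSpan ℝ (M.elem T ∩ M.elem S)) + 2 ≤ d := by
  have hle : finrank ℝ (vectorSpan ℝ (M.elem T ∩ M.elem S)) ≤ d := by
    simpa using Submodule.finrank_le (vectorSpan ℝ (M.elem T ∩ M.elem S))
  have hne_zero : finrank ℝ (vectorSpan ℝ (M.elem T ∩ M.elem S)) ≠ d := fun h =>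
    hTS (eq_of_vectorSpan_inter_eq_top hne (Submodule.eq_top_of_finrank_eq (by simpa using h)))
  have hne_one : finrank ℝ (vectorSpan ℝ (M.elem T ∩ M.elem S)) + 1 ≠ d := by
    intro h
    have hT : IsFacet (M.elem T) (M.elem T ∩ M.elem S) := ⟨hne, M.conforming T S, h⟩
    have hS : IsFacet (M.elem S) (M.elem T ∩ M.elem S) :=
      ⟨hne, inter_comm (M.elem S) _ ▸ M.conforming S T, h⟩
    obtain ⟨F, hF'⟩ : M.elem T ∩ M.elem S ∈ range M.iface := by
      rw [M.range_iface]
      exact ⟨T, S, hTS, hT, hS⟩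
    exact hF F (hF' ▸ hT) (hF' ▸ hS)
  omega

theorem finrank_vectorSpan_inter_le_of_face_closed {A : Set ι}
    (hA : ∀ F, M.minus F ∈ A ↔ M.plus F ∈ A) {T S : ι} (hT : T ∈ A) (hS : S ∉ A)
    (hne : (M.elem T ∩ M.elem S).Nonempty) :
    finrank ℝ (vectorSpan ℝ (M.elem T ∩ M.elem S)) + 2 ≤ d := by
  have hTS : T ≠ S := ne_of_mem_of_not_mem hT hS
  refine finrank_vectorSpan_inter_le hTS hne fun F hFT hFS => ?_
  have hsides := fun R => eq_or_eq_of_isFacet (R := R) (M.minus_ne_plus F)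
    (M.facet_minus F) (M.facet_plus F)
  rcases hsides T hFT with rfl | rfl <;> rcases hsides S hFS with rfl | rfl
  · exact hTS rfl
  · exact hS ((hA F).1 hT)
  · exact hS ((hA F).2 hT)
  · exact hTS rfl

end Mesh

section Codimension

variable {V : Type*} [NormedAddCommGroup V] [NormedSpace ℝ V]

theorem mem_affineSpan_insert_of_mem_segment {P : Set V} {a c z : V} (ha : a ∉ P)
    (hz : z ∈ P) (hzs : z ∈ segment ℝ a c) : c ∈ affineSpan ℝ (insert a P) := by
  rw [segment_eq_image_lineMap] at hzs
  obtain ⟨t, -, rfl⟩ := hzs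
  have ht : t ≠ 0 := by
    rintro rfl
    exact ha (by simpa using hz)
  have h := AffineMap.lineMap_mem t⁻¹ (mem_affineSpan ℝ (mem_insert a P))
    (mem_affineSpan ℝ (mem_insert_of_mem a hz))
  rwa [AffineMap.lineMap_lineMap_right, inv_mul_cancel₀ ht, AffineMap.lineMap_apply_one] at h

theorem exists_mem_forall_notMem_affineSpan [FiniteDimensional ℝ V] {κ : Type*} [Countable κ]
    {U : Set V} (hU : IsOpen U) (hne : U.Nonempty) (P : κ → Set V)
    (hP : ∀ k, finrank ℝ (vectorSpan ℝ (P k)) < finrank ℝ V) :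
    ∃ x ∈ U, ∀ k, x ∉ affineSpan ℝ (P k) := by
  have : CompleteSpace V := FiniteDimensional.complete ℝ V
  have hdense : Dense (⋂ k, ((affineSpan ℝ (P k) : Set V)ᶜ)) := by
    refine dense_iInter_of_isOpen
      (fun k => (AffineSubspace.closed_of_finiteDimensional _).isOpen_compl) fun k => ?_
    rw [← interior_eq_empty_iff_dense_compl, ← not_nonempty_iff_eq_empty,
      (affineSpan ℝ (P k)).convex.interior_nonempty_iff_affineSpan_eq_top,
      AffineSubspace.affineSpan_coe]
    intro h
    have hlt := hP k
    rw [← direction_affineSpan, h, AffineSubspace.direction_top, finrank_top] at hlt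
    exact hlt.false
  obtain ⟨x, hxU, hx⟩ := hdense.inter_open_nonempty U hU hne
  exact ⟨x, hxU, fun k => mem_iInter.1 hx k⟩

theorem exists_forall_disjoint_segment [FiniteDimensional ℝ V] {κ : Type*} [Countable κ]
    {U₁ U₂ : Set V} (hU₁ : IsOpen U₁) (hne₁ : U₁.Nonempty) (hU₂ : IsOpen U₂) (hne₂ : U₂.Nonempty)
    (P : κ → Set V) (hP : ∀ k, finrank ℝ (vectorSpan ℝ (P k)) + 2 ≤ finrank ℝ V) :
    ∃ a ∈ U₁, ∃ c ∈ U₂, ∀ k, Disjoint (segment ℝ a c) (P k) := by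
  obtain ⟨a, ha, haP⟩ := exists_mem_forall_notMem_affineSpan hU₁ hne₁ P fun k => by
    have := hP k
    omega
  obtain ⟨c, hc, hcP⟩ := exists_mem_forall_notMem_affineSpan hU₂ hne₂ (fun k => insert a (P k))
    fun k => by
      have := hP k
      have := finrank_vectorSpan_insert_le_set ℝ (P k) a
      omega
  refine ⟨a, ha, c, hc, fun k => disjoint_left.2 fun z hzs hzP => hcP k ?_⟩
  exact mem_affineSpan_insert_of_mem_segment (fun h => haP k (mem_affineSpan ℝ h)) hzP hzs

end Codimension

namespace Mesh

variable {d : ℕ} {ι I B : Type*} [Finite ι] {M : Mesh d ι I B}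

theorem exists_mem_inter_of_isPreconnected {A : Set ι} {C : Set (E d)} (hC : IsPreconnected C)
    (hCΩ : C ⊆ M.domain) {T S : ι} (hT : T ∈ A) (hS : S ∉ A) (hCT : (C ∩ M.elem T).Nonempty)
    (hCS : (C ∩ M.elem S).Nonempty) :
    ∃ T ∈ A, ∃ S ∉ A, ∃ x ∈ C, x ∈ M.elem T ∩ M.elem S := by
  have hclosed : ∀ A : Set ι, IsClosed (⋃ T ∈ A, M.elem T) := fun A =>
    A.toFinite.isClosed_biUnion fun T _ => (M.isBody T).isCompact.isClosed
  have hcover : C ⊆ (⋃ T ∈ A, M.elem T) ∪ ⋃ T ∈ Aᶜ, M.elem T := by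
    intro x hx
    obtain ⟨T, hxT⟩ := mem_iUnion.1 (interior_subset (hCΩ hx))
    exact (em (T ∈ A)).imp (mem_biUnion · hxT) (mem_biUnion · hxT)
  obtain ⟨x, hxC, hxA, hxA'⟩ := isPreconnected_closed_iff.1 hC _ _ (hclosed A) (hclosed Aᶜ) hcover
    (hCT.mono (inter_subset_inter_right C (subset_biUnion_of_mem hT)))
    (hCS.mono (inter_subset_inter_right C (subset_biUnion_of_mem (mem_compl hS))))
  obtain ⟨T, hT, hxT⟩ := mem_iUnion₂.1 hxA
  obtain ⟨S, hS, hxS⟩ := mem_iUnion₂.1 hxA'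
  exact ⟨T, hT, S, hS, x, hxC, hxT, hxS⟩

theorem eq_univ_of_face_closed (hΩ : IsPreconnected M.domain) {A : Set ι} (hne : A.Nonempty)
    (hA : ∀ F, M.minus F ∈ A ↔ M.plus F ∈ A) : A = univ := by
  obtain ⟨T₀, hT₀⟩ := hne
  by_contra hne_univ
  obtain ⟨S₀, hS₀⟩ := (ne_univ_iff_exists_notMem A).1 hne_univ
  have hmeet : ∀ T, (M.domain ∩ M.elem T).Nonempty := fun T =>
    (M.isBody T).nonempty_interior.mono
      (subset_inter (M.interior_elem_subset_domain T) interior_subset)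
  obtain ⟨T, hT, S, hS, x, hxΩ, hxT, hxS⟩ :=
    exists_mem_inter_of_isPreconnected hΩ subset_rfl hT₀ hS₀ (hmeet T₀) (hmeet S₀)
  obtain ⟨r, hr, hball⟩ := Metric.isOpen_iff.1 (isOpen_interior : IsOpen M.domain) x hxΩ
  have hopen : ∀ R, x ∈ M.elem R → (Metric.ball x r ∩ interior (M.elem R)).Nonempty := fun R hxR =>
    mem_closure_iff.1 ((M.isBody R).subset_closure_interior hxR) _ Metric.isOpen_ball
      (Metric.mem_ball_self hr)
  -- Near `x`, a generic segment from `T` to `S` avoids all the intersections of an element of `A`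
  -- with one outside `A`, which have codimension at least two.
  obtain ⟨a, ⟨hax, haT⟩, c, ⟨hcx, hcS⟩, hdisj⟩ := exists_forall_disjoint_segment
    (Metric.isOpen_ball.inter isOpen_interior) (hopen T hxT)
    (Metric.isOpen_ball.inter isOpen_interior) (hopen S hxS)
    (fun k : {k : ι × ι // k.1 ∈ A ∧ k.2 ∉ A ∧ (M.elem k.1 ∩ M.elem k.2).Nonempty} =>
      M.elem k.1.1 ∩ M.elem k.1.2)
    fun k => by
      simpa using finrank_vectorSpan_inter_le_of_face_closed hA k.2.1 k.2.2.1 k.2.2.2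
  obtain ⟨T', hT', S', hS', z, hz, hzTS⟩ := exists_mem_inter_of_isPreconnected
    (convex_segment a c).isPreconnected
    (((convex_ball x r).segment_subset hax hcx).trans hball) hT hS
    ⟨a, left_mem_segment ℝ a c, interior_subset haT⟩
    ⟨c, right_mem_segment ℝ a c, interior_subset hcS⟩
  exact disjoint_left.1 (hdisj ⟨(T', S'), hT', hS', z, hzTS⟩) hz hzTS

end Mesh

end Biot

namespace Biot

open MeasureTheory Set

/-! ### Integrals of polynomials over elements and faces -/

section Val

variable {d : ℕ}

@[fun_prop] theorem continuous_val (f : MvPolynomial (Fin d) ℝ) : Continuous (val f) :=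
  (MvPolynomial.continuous_eval f).comp (by fun_prop)

@[simp] theorem val_add (f g : MvPolynomial (Fin d) ℝ) (x : E d) :
    val (f + g) x = val f x + val g x := by simp [val]

@[simp] theorem val_sub (f g : MvPolynomial (Fin d) ℝ) (x : E d) :
    val (f - g) x = val f x - val g x := by simp [val]

@[simp] theorem val_smul (c : ℝ) (f : MvPolynomial (Fin d) ℝ) (x : E d) :
    val (c • f) x = c * val f x := by simp [val]

@[simp] theorem val_sum {α : Type*} (s : Finset α) (f : α → MvPolynomial (Fin d) ℝ) (x : E d) :
    val (∑ i ∈ s, f i) x = ∑ i ∈ s, val (f i) x := by simp [val]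

theorem eq_zero_of_forall_val_eq_zero {T : Set (E d)} (hT : (interior T).Nonempty)
    {f : MvPolynomial (Fin d) ℝ} (hf : ∀ x ∈ T, val f x = 0) : f = 0 := by
  obtain ⟨x, hx⟩ := hT
  have hopen : IsOpen ((WithLp.toLp 2 : (Fin d → ℝ) → E d) ⁻¹' interior T) :=
    isOpen_interior.preimage (PiLp.continuous_toLp 2 _)
  obtain ⟨r, hr, hball⟩ := Metric.isOpen_iff.1 hopen (WithLp.ofLp x) (by simpa using hx)
  refine MvPolynomial.funext_set (fun i => Metric.ball (x i) r) (fun i => ?_) fun y hy => ?_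
  · rw [Real.ball_eq_Ioo]
    exact Ioo_infinite (by linarith)
  · have hy' : y ∈ Metric.ball (WithLp.ofLp x) r :=
      (dist_pi_lt_iff hr).2 fun i => hy i (mem_univ i)
    simpa [val] using hf _ (interior_subset (hball hy'))

end Val

/-- A compact set of finite measure all of whose nonempty relatively open subsets have positive
measure: a continuous nonnegative function on it vanishes as soon as its integral does. This is
the common property of the elements with the volume and of the faces with the surface measure. -/
structure IsThick {X : Type*} [TopologicalSpace X] [MeasurableSpace X] (μ : Measure X)
    (K : Set X) : Prop where
  isCompact : IsCompact K
  measure_lt_top : μ K < ⊤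
  measure_pos : ∀ U, IsOpen U → (K ∩ U).Nonempty → 0 < μ (K ∩ U)

namespace IsThick

section Continuous

variable {X : Type*} [TopologicalSpace X] [T2Space X] [MeasurableSpace X] [BorelSpace X]
  {μ : Measure X} {K : Set X} {f : X → ℝ}

theorem integrableOn (h : IsThick μ K) (hf : Continuous f) : IntegrableOn f K μ := by
  obtain ⟨C, hC⟩ := h.isCompact.exists_bound_of_continuousOn hf.continuousOn
  exact IntegrableOn.of_bound h.measure_lt_top hf.aestronglyMeasurable C
    ((ae_restrict_iff' h.isCompact.measurableSet).2 (.of_forall hC))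

theorem eq_zero_of_setIntegral_eq_zero (h : IsThick μ K) (hf : Continuous f) (hf0 : ∀ x, 0 ≤ f x)
    (hint : ∫ x in K, f x ∂μ = 0) : ∀ x ∈ K, f x = 0 := by
  rw [setIntegral_eq_zero_iff_of_nonneg_ae (.of_forall hf0) (h.integrableOn hf),
    Filter.EventuallyEq, ae_restrict_iff' h.isCompact.measurableSet, ae_iff] at hint
  intro x hx
  by_contra hne
  refine (h.measure_pos {y | f y ≠ 0} (isOpen_ne_fun hf continuous_const) ⟨x, hx, hne⟩).ne'
    (measure_mono_null ?_ hint)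
  rintro y ⟨hy, hy'⟩
  simpa using ⟨hy, hy'⟩

end Continuous

theorem image_of_isometry {X Y : Type*} [MetricSpace X] [MeasurableSpace X] [BorelSpace X]
    [MetricSpace Y] [MeasurableSpace Y] [BorelSpace Y] {n : ℕ} {φ : X → Y} (hφ : Isometry φ)
    {K : Set X} (hK : IsThick (Measure.euclideanHausdorffMeasure n) K) :
    IsThick (Measure.euclideanHausdorffMeasure n) (φ '' K) := by
  refine ⟨hK.isCompact.image hφ.continuous, ?_, fun U hU hne => ?_⟩
  · rw [hφ.euclideanHausdorffMeasure_image]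
    exact hK.measure_lt_top
  · rw [← image_inter_preimage] at hne ⊢
    rw [hφ.euclideanHausdorffMeasure_image]
    exact hK.measure_pos _ (hU.preimage hφ.continuous) hne.of_image

end IsThick

theorem IsBody.isThick {V : Type*} [NormedAddCommGroup V] [NormedSpace ℝ V] [MeasurableSpace V]
    {μ : Measure V} [IsFiniteMeasureOnCompacts μ] [μ.IsOpenPosMeasure] {T : Set V}
    (hT : IsBody T) : IsThick μ T := by
  refine ⟨hT.isCompact, hT.isCompact.measure_lt_top, fun U hU ⟨x, hx, hxU⟩ => ?_⟩
  have hne := mem_closure_iff.1 (hT.subset_closure_interior hx) U hU hxU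
  exact ((hU.inter isOpen_interior).measure_pos μ hne).trans_le
    (measure_mono fun y hy => ⟨interior_subset hy.2, hy.1⟩)

theorem IsFacet.isThick {d : ℕ} {T F : Set (E d)} (hF : IsFacet T F) (hT : IsBody T) :
    IsThick (Measure.euclideanHausdorffMeasure (d - 1)) F := by
  obtain ⟨x₀, hx₀⟩ := hF.1
  have hdim : d - 1 = Module.finrank ℝ (vectorSpan ℝ F) := by
    have := hF.2.2
    omega
  have h := IsThick.image_of_isometry (n := Module.finrank ℝ (vectorSpan ℝ F))
    (spanChart F x₀).isometry
    (isBody_preimage_spanChart (hF.isCompact hT) (hF.convex hT) hx₀).isThick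
  rwa [image_preimage_spanChart hx₀, ← hdim] at h

end Biot

namespace Biot

open MvPolynomial Matrix

/-! ### Infinitesimal rigid motions -/

section PartialDerivatives

variable {σ R : Type*} [CommRing R]

theorem pderiv_pderiv_comm (i j : σ) (f : MvPolynomial σ R) :
    pderiv i (pderiv j f) = pderiv j (pderiv i f) := by
  classical
  let D : Derivation R (MvPolynomial σ R) (MvPolynomial σ R) :=
    ⁅(pderiv i : Derivation R (MvPolynomial σ R) (MvPolynomial σ R)), pderiv j⁆
  have h : D = 0 := derivation_ext fun k => by
    simp [D, Derivation.commutator_apply, pderiv_X, Pi.single_apply, apply_ite]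
  exact sub_eq_zero.1 (DFunLike.congr_fun h f)

theorem eq_C_of_pderiv_eq_zero [NoZeroDivisors R] [CharZero R] {p : MvPolynomial σ R}
    (hp : ∀ i, pderiv i p = 0) : p = C (coeff 0 p) := by
  classical
  ext m
  rw [coeff_C]
  split_ifs with h
  · rw [← h]
  · obtain ⟨i, hi⟩ : ∃ i, m i ≠ 0 := by
      by_contra! hcon
      exact h (Finsupp.ext fun i => (hcon i).symm)
    have hm : m - Finsupp.single i 1 + Finsupp.single i 1 = m :=
      tsub_add_cancel_of_le (Finsupp.single_le_iff.2 (Nat.one_le_iff_ne_zero.2 hi))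
    have hcoeff := congrArg (coeff (m - Finsupp.single i 1)) (hp i)
    rw [coeff_pderiv, hm, coeff_zero] at hcoeff
    exact (mul_eq_zero.1 hcoeff).resolve_right (Nat.cast_add_one_ne_zero _)

end PartialDerivatives

theorem eq_zero_of_transpose_eq_neg_of_ker {n K : Type*} [Fintype n] [Field K] [CharZero K]
    {S : Matrix n n K} (hS : Sᵀ = -S) {l : Module.Dual K (n → K)}
    (hl : ∀ w ∈ LinearMap.ker l, S *ᵥ w = 0) : S = 0 := by
  have hskew : ∀ x y, (S *ᵥ x) ⬝ᵥ y = -((S *ᵥ y) ⬝ᵥ x) := by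
    intro x y
    rw [dotProduct_comm _ x, dotProduct_mulVec x, ← mulVec_transpose, hS, neg_mulVec,
      neg_dotProduct, neg_neg]
  refine mulVec_injective (funext fun x => ?_)
  rw [zero_mulVec]
  refine dotProduct_eq_zero _ fun y => ?_
  by_cases hx : l x = 0
  · rw [hl x hx, zero_dotProduct]
  -- `y` lies in the span of `x` and the hyperplane, and `S x` is orthogonal to both.
  have hker : y - (l y / l x) • x ∈ LinearMap.ker l := by
    rw [LinearMap.mem_ker, map_sub, map_smul, smul_eq_mul, div_mul_cancel₀ _ hx, sub_self]
  have hself : (S *ᵥ x) ⬝ᵥ x = 0 := self_eq_neg.1 (hskew x x)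
  rw [← sub_add_cancel y ((l y / l x) • x), dotProduct_add, dotProduct_smul, hself, hskew,
    hl _ hker, zero_dotProduct, neg_zero, smul_zero, add_zero]

/-- An infinitesimal rigid motion: a polynomial vector field whose strain vanishes. -/
def IsRigidMotion {d : ℕ} (v : Fin d → MvPolynomial (Fin d) ℝ) : Prop :=
  ∀ i j, pderiv j (v i) + pderiv i (v j) = 0

namespace IsRigidMotion

variable {d : ℕ} {u v : Fin d → MvPolynomial (Fin d) ℝ}

theorem sub (hu : IsRigidMotion u) (hv : IsRigidMotion v) : IsRigidMotion (u - v) := by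
  intro i j
  simp only [Pi.sub_apply, map_sub]
  linear_combination hu i j - hv i j

theorem pderiv_eq_neg (hv : IsRigidMotion v) (i j : Fin d) :
    pderiv j (v i) = -pderiv i (v j) :=
  eq_neg_of_add_eq_zero_left (hv i j)

theorem pderiv_pderiv_eq_zero (hv : IsRigidMotion v) (i j k : Fin d) :
    pderiv k (pderiv j (v i)) = 0 := by
  refine self_eq_neg.1 ?_
  calc pderiv k (pderiv j (v i)) = -pderiv i (pderiv k (v j)) := by
        rw [hv.pderiv_eq_neg i j, map_neg, pderiv_pderiv_comm]
    _ = pderiv j (pderiv i (v k)) := by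
        rw [hv.pderiv_eq_neg j k, map_neg, neg_neg, pderiv_pderiv_comm]
    _ = -pderiv k (pderiv j (v i)) := by
        rw [hv.pderiv_eq_neg k i, map_neg, pderiv_pderiv_comm]

theorem exists_eq_add_mulVec (hv : IsRigidMotion v) :
    ∃ (b : Fin d → ℝ) (S : Matrix (Fin d) (Fin d) ℝ), Sᵀ = -S ∧
      ∀ i (x : E d), val (v i) x = b i + (S *ᵥ x) i := by
  let S : Matrix (Fin d) (Fin d) ℝ := fun i j => coeff 0 (pderiv j (v i))
  have hS : ∀ i j, pderiv j (v i) = C (S i j) := fun i j =>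
    eq_C_of_pderiv_eq_zero (hv.pderiv_pderiv_eq_zero i j)
  have hlin : ∀ i, v i - ∑ j, C (S i j) * X j = C (coeff 0 (v i - ∑ j, C (S i j) * X j)) := by
    refine fun i => eq_C_of_pderiv_eq_zero fun k => ?_
    simp [hS, pderiv_X, Pi.single_apply]
  refine ⟨fun i => coeff 0 (v i - ∑ j, C (S i j) * X j), S, ?_, fun i x => ?_⟩
  · ext i j
    exact (congrArg (coeff 0) (hv.pderiv_eq_neg j i)).trans (coeff_neg _ _ _)
  · rw [← sub_eq_iff_eq_add]
    simpa [val, mulVec, dotProduct] using congrArg (val · x) (hlin i)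

theorem eq_zero_of_hyperplane (hv : IsRigidMotion v) {F : Set (E d)} (hne : F.Nonempty)
    (hF : Module.finrank ℝ (vectorSpan ℝ F) + 1 = d) (h0 : ∀ x ∈ F, ∀ i, val (v i) x = 0) :
    v = 0 := by
  obtain ⟨b, S, hskew, hval⟩ := hv.exists_eq_add_mulVec
  have hspan : vectorSpan ℝ F ≤
      LinearMap.ker (S.mulVecLin ∘ₗ (WithLp.linearEquiv 2 ℝ (Fin d → ℝ)).toLinearMap) := by
    refine vectorSpan_le_ker_iff.2 fun x hx y hy => funext fun i => ?_
    have h := (h0 x hx i).trans (h0 y hy i).symm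
    rw [hval, hval] at h
    exact add_left_cancel h
  obtain ⟨l, hl⟩ := exists_dual_ker_eq (W := vectorSpan ℝ F) (by simpa using hF)
  have hS : S = 0 := eq_zero_of_transpose_eq_neg_of_ker hskew
    (l := l ∘ₗ (WithLp.linearEquiv 2 ℝ (Fin d → ℝ)).symm) fun w hw =>
      hspan (hl ▸ hw : (WithLp.linearEquiv 2 ℝ (Fin d → ℝ)).symm w ∈ vectorSpan ℝ F)
  obtain ⟨x₀, hx₀⟩ := hne
  have hb : ∀ i, b i = 0 := fun i => by simpa [hval, hS] using h0 x₀ hx₀ i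
  funext i
  exact eq_zero_of_forall_val_eq_zero (T := Set.univ) (by simp) fun x _ => by simp [hval, hS, hb]

end IsRigidMotion

theorem Mesh.eq_zero_of_isRigidMotion {d : ℕ} {ι I B : Type*} [Finite ι] {M : Mesh d ι I B}
    (hΩ : IsPreconnected M.domain) {F₀ : B} {v : Vect d ι} (hv : ∀ T, IsRigidMotion (v T))
    (hj : ∀ F, ∀ x ∈ M.iface F, ∀ i, M.jump v F i x = 0)
    (hb : ∀ x ∈ M.bface F₀, ∀ i, val (v (M.owner F₀) i) x = 0) : v = 0 := by
  have hstep : ∀ F, v (M.minus F) = v (M.plus F) := fun F =>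
    sub_eq_zero.1 <| ((hv _).sub (hv _)).eq_zero_of_hyperplane (M.facet_minus F).1
      (M.facet_minus F).2.2 fun x hx i => (val_sub _ _ x).trans (hj F x hx i)
  have huniv : {T | v T = 0} = Set.univ := eq_univ_of_face_closed hΩ
    ⟨M.owner F₀, (hv _).eq_zero_of_hyperplane (M.facet_owner F₀).1 (M.facet_owner F₀).2.2 hb⟩
    fun F => by simp only [Set.mem_ofPred_eq, hstep F]
  exact funext fun T => (Set.ext_iff.1 huniv T).2 trivial

end Biot

namespace Biot

open LinearMap (BilinForm)

/-! ### Comparison of positive semidefinite forms -/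

section PosSemidef

variable {V : Type*} [AddCommGroup V] [Module ℝ V] {A B : BilinForm ℝ V}

theorem isPosSemidef_comp (hB : B.IsPosSemidef) {V' : Type*} [AddCommGroup V'] [Module ℝ V']
    (f : V' →ₗ[ℝ] V) : (B.comp f f).IsPosSemidef where
  eq x y := hB.eq (f x) (f y)
  nonneg x := hB.nonneg (f x)

theorem two_mul_apply_le_of_isPosSemidef (hB : B.IsPosSemidef) (x y : V) {s : ℝ} (hs : 0 < s) :
    2 * B x y ≤ s * B x x + s⁻¹ * B y y := by
  have hsq := mul_nonneg (inv_pos.2 hs).le (hB.nonneg (s • x - y))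
  have hsymm : B y x = B x y := hB.eq y x
  have hexpand : s⁻¹ * B (s • x - y) (s • x - y) = s * B x x - 2 * B x y + s⁻¹ * B y y := by
    simp only [map_sub, map_smul, LinearMap.sub_apply, LinearMap.smul_apply, smul_eq_mul, hsymm]
    field_simp
    ring
  linarith

theorem apply_sum_self_le_card_mul_sum (hB : B.IsPosSemidef) {κ : Type*} (s : Finset κ)
    (x : κ → V) : B (∑ i ∈ s, x i) (∑ i ∈ s, x i) ≤ s.card * ∑ i ∈ s, B (x i) (x i) := by
  have hexpand : B (∑ i ∈ s, x i) (∑ i ∈ s, x i) = ∑ i ∈ s, ∑ j ∈ s, B (x i) (x j) := by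
    simp only [map_sum, LinearMap.sum_apply]
    exact Finset.sum_comm
  have hyoung : ∑ i ∈ s, ∑ j ∈ s, 2 * B (x i) (x j) ≤
      ∑ i ∈ s, ∑ j ∈ s, (B (x i) (x i) + B (x j) (x j)) :=
    Finset.sum_le_sum fun i _ => Finset.sum_le_sum fun j _ => by
      simpa using two_mul_apply_le_of_isPosSemidef hB (x i) (x j) one_pos
  simp only [Finset.sum_add_distrib, Finset.sum_const, nsmul_eq_mul, ← Finset.mul_sum] at hyoung
  linarith

theorem apply_sum_self_of_isOrthoᵢ {κ : Type*} (s : Finset κ) {x : κ → V} (hx : A.IsOrthoᵢ x) :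
    A (∑ i ∈ s, x i) (∑ i ∈ s, x i) = ∑ i ∈ s, A (x i) (x i) := by
  simp only [map_sum, LinearMap.sum_apply]
  exact Finset.sum_congr rfl fun i hi =>
    Finset.sum_eq_single i (fun j _ hji => hx hji) fun h => absurd hi h

theorem exists_apply_self_le_mul [FiniteDimensional ℝ V] (hA : A.IsPosSemidef)
    (hB : B.IsPosSemidef) (h : ∀ x, A x x = 0 → B x x = 0) :
    ∃ C : ℝ, 0 ≤ C ∧ ∀ x, B x x ≤ C * A x x := by
  have : Invertible (2 : ℝ) := invertibleOfNonzero two_ne_zero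
  obtain ⟨b, hb⟩ := LinearMap.BilinForm.exists_orthogonal_basis
    (LinearMap.BilinForm.isSymm_iff.1 hA.isSymm)
  let c : Fin (Module.finrank ℝ V) → ℝ := fun i => B (b i) (b i) / A (b i) (b i)
  have hc : ∀ i, 0 ≤ c i := fun i => div_nonneg (hB.nonneg _) (hA.nonneg _)
  have hcb : ∀ i, B (b i) (b i) = c i * A (b i) (b i) := by
    intro i
    by_cases h0 : A (b i) (b i) = 0
    · rw [h _ h0, h0, mul_zero]
    · exact (div_mul_cancel₀ _ h0).symm
  refine ⟨Module.finrank ℝ V * ∑ i, c i, mul_nonneg (Nat.cast_nonneg _)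
    (Finset.sum_nonneg fun i _ => hc i), fun x => ?_⟩
  let y : Fin (Module.finrank ℝ V) → V := fun i => b.repr x i • b i
  have hy : A.IsOrthoᵢ y := fun i j hij => by
    have hbij : A (b i) (b j) = 0 := hb hij
    simp [y, Function.onFun, hbij]
  have hBy : ∀ i, B (y i) (y i) = c i * A (y i) (y i) := fun i => by
    simp only [y, map_smul, LinearMap.smul_apply, smul_eq_mul, hcb]
    ring
  have hle : ∀ i, c i * A (y i) (y i) ≤ (∑ j, c j) * A (y i) (y i) := fun i =>
    mul_le_mul_of_nonneg_right
      (Finset.single_le_sum (fun j _ => hc j) (Finset.mem_univ i)) (hA.nonneg _)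
  calc B x x = B (∑ i, y i) (∑ i, y i) := by rw [b.sum_repr x]
    _ ≤ Module.finrank ℝ V * ∑ i, B (y i) (y i) := by
      simpa using apply_sum_self_le_card_mul_sum hB Finset.univ y
    _ ≤ Module.finrank ℝ V * ∑ i, (∑ j, c j) * A (y i) (y i) := by
      simp only [hBy]
      exact mul_le_mul_of_nonneg_left (Finset.sum_le_sum fun i _ => hle i) (Nat.cast_nonneg _)
    _ = Module.finrank ℝ V * (∑ i, c i) * A x x := by
      rw [← Finset.mul_sum, ← apply_sum_self_of_isOrthoᵢ _ hy, b.sum_repr x, mul_assoc]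

theorem exists_forall_penalty_coercive [FiniteDimensional ℝ V] {S J G N X : BilinForm ℝ V}
    (hS : S.IsPosSemidef) (hJ : J.IsPosSemidef) (hG : G.IsPosSemidef) (hN : N.IsPosSemidef)
    (hX : ∀ v, ∀ s > 0, 2 * X v v ≤ s * N v v + s⁻¹ * J v v)
    (htrace : ∀ v, S v v = 0 → N v v = 0) (hKorn : ∀ v, S v v = 0 → J v v = 0 → G v v = 0) :
    ∃ β₀ : ℝ, 0 < β₀ ∧ ∀ β ≥ β₀, ∃ κ : ℝ, 0 < κ ∧
      ∀ v, κ * (G v v + β * J v v) ≤ 2 * S v v + β * J v v - 4 * X v v := by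
  obtain ⟨C, hC, hNS⟩ := exists_apply_self_le_mul hS hN htrace
  obtain ⟨D, hD, hGS⟩ := exists_apply_self_le_mul (hS.add hJ) hG fun v hv =>
    let h := (add_eq_zero_iff_of_nonneg (hS.nonneg v) (hJ.nonneg v)).1 hv
    hKorn v h.1 h.2
  refine ⟨8 * (C + 1), by positivity, fun β hβ => ⟨(2 * D + 4)⁻¹, by positivity, fun v => ?_⟩⟩
  have hSv := hS.nonneg v
  have hJv := hJ.nonneg v
  have hβJ : 8 * (C + 1) * J v v ≤ β * J v v := mul_le_mul_of_nonneg_right hβ hJv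
  have hCJ : 0 ≤ C * J v v := mul_nonneg hC hJv
  -- With this weight half of the strain absorbs the consistency terms.
  have hcons : 2 * X v v ≤ S v v / 2 + 2 * (C + 1) * J v v := by
    have hflux : (2 * (C + 1))⁻¹ * N v v ≤ S v v / 2 := by
      rw [inv_mul_le_iff₀ (by positivity)]
      linarith [hNS v]
    have := hX v (2 * (C + 1))⁻¹ (by positivity)
    rw [inv_inv] at this
    linarith
  have hnorm : (2 * D + 4)⁻¹ * (G v v + β * J v v) ≤ S v v / 2 + J v v / 2 + β * J v v / 4 := by
    have hGv : G v v ≤ D * (S v v + J v v) := hGS v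
    have hDβ : 0 ≤ D * (β * J v v) := mul_nonneg hD (by linarith)
    rw [inv_mul_le_iff₀ (by positivity)]
    linarith
  linarith

end PosSemidef

end Biot

namespace Biot

open MeasureTheory
open LinearMap (BilinForm)

/-! ### The discrete forms as bilinear forms -/

section L2

variable {d : ℕ} {μ : Measure (E d)} {α κ : Type*} [Fintype α] [Fintype κ] {K : α → Set (E d)}

theorem IsThick.integrableOn_sum_val_mul {K : Set (E d)} (h : IsThick μ K)
    (p q : κ → MvPolynomial (Fin d) ℝ) :
    IntegrableOn (fun x => ∑ k, val (p k) x * val (q k) x) K μ :=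
  h.integrableOn (by fun_prop)

/-- The `L²` inner product of families of polynomials with `κ` components, each of which lives on
all the sets `K a`. -/
noncomputable def l2Form (h : ∀ a, IsThick μ (K a)) :
    BilinForm ℝ (α → κ → MvPolynomial (Fin d) ℝ) :=
  LinearMap.mk₂ ℝ (fun p q => ∑ a, ∫ x in K a, ∑ k, val (p a k) x * val (q a k) x ∂μ)
    (fun p p' q => by
      simp only [Pi.add_apply, val_add, add_mul, Finset.sum_add_distrib]
      simp only [integral_add ((h _).integrableOn_sum_val_mul _ _)
        ((h _).integrableOn_sum_val_mul _ _), Finset.sum_add_distrib])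
    (fun c p q => by
      simp only [Pi.smul_apply, val_smul, mul_assoc, ← Finset.mul_sum, integral_const_mul,
        smul_eq_mul])
    (fun p q q' => by
      simp only [Pi.add_apply, val_add, mul_add, Finset.sum_add_distrib]
      simp only [integral_add ((h _).integrableOn_sum_val_mul _ _)
        ((h _).integrableOn_sum_val_mul _ _), Finset.sum_add_distrib])
    (fun c p q => by
      simp only [Pi.smul_apply, val_smul, mul_left_comm _ c, ← Finset.mul_sum, integral_const_mul,
        smul_eq_mul])

theorem l2Form_apply (h : ∀ a, IsThick μ (K a)) (p q : α → κ → MvPolynomial (Fin d) ℝ) :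
    l2Form h p q = ∑ a, ∫ x in K a, ∑ k, val (p a k) x * val (q a k) x ∂μ := rfl

theorem isPosSemidef_l2Form (h : ∀ a, IsThick μ (K a)) :
    (l2Form h : BilinForm ℝ (α → κ → MvPolynomial (Fin d) ℝ)).IsPosSemidef where
  eq p q := by simp only [l2Form_apply, mul_comm]
  nonneg p := Finset.sum_nonneg fun _ _ => integral_nonneg fun _ =>
    Finset.sum_nonneg fun _ _ => mul_self_nonneg _

theorem val_eq_zero_of_l2Form_self_eq_zero (h : ∀ a, IsThick μ (K a))
    {p : α → κ → MvPolynomial (Fin d) ℝ} (hp : l2Form h p p = 0) (a : α) :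
    ∀ x ∈ K a, ∀ k, val (p a k) x = 0 := by
  have hsq : ∀ a x, 0 ≤ ∑ k, val (p a k) x * val (p a k) x := fun _ _ =>
    Finset.sum_nonneg fun _ _ => mul_self_nonneg _
  intro x hx k
  have hint := (Finset.sum_eq_zero_iff_of_nonneg fun a _ => integral_nonneg (hsq a)).1 hp a
    (Finset.mem_univ a)
  have hsum := (h a).eq_zero_of_setIntegral_eq_zero (by fun_prop) (hsq a) hint x hx
  exact mul_self_eq_zero.1 <| (Finset.sum_eq_zero_iff_of_nonneg fun _ _ =>
    mul_self_nonneg _).1 hsum k (Finset.mem_univ k)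

theorem eq_zero_of_l2Form_self_eq_zero (h : ∀ a, IsThick μ (K a))
    (hK : ∀ a, (interior (K a)).Nonempty) {p : α → κ → MvPolynomial (Fin d) ℝ}
    (hp : l2Form h p p = 0) : p = 0 :=
  funext fun a => funext fun k => eq_zero_of_forall_val_eq_zero (hK a) fun x hx =>
    val_eq_zero_of_l2Form_self_eq_zero h hp a x hx k

end L2

section Strain

variable {d : ℕ}

/-- The gradient of a polynomial vector field, with the entry `∂ⱼ vᵢ` at `(i, j)`. -/
noncomputable def gradMap :
    (Fin d → MvPolynomial (Fin d) ℝ) →ₗ[ℝ] (Fin d × Fin d → MvPolynomial (Fin d) ℝ) :=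
  LinearMap.pi fun k => (MvPolynomial.pderiv k.2).toLinearMap ∘ₗ LinearMap.proj k.1

/-- The strain of a polynomial vector field. -/
noncomputable def strainMap :
    (Fin d → MvPolynomial (Fin d) ℝ) →ₗ[ℝ] (Fin d × Fin d → MvPolynomial (Fin d) ℝ) :=
  (2⁻¹ : ℝ) • (gradMap + LinearMap.funLeft ℝ _ Prod.swap ∘ₗ gradMap)

/-- The normal strain `ε(v) n` of a polynomial vector field. -/
noncomputable def normalStrainMap (n : E d) :
    (Fin d → MvPolynomial (Fin d) ℝ) →ₗ[ℝ] (Fin d → MvPolynomial (Fin d) ℝ) :=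
  (LinearMap.pi fun i => ∑ j, n j • LinearMap.proj (i, j)) ∘ₗ strainMap

variable (v : Fin d → MvPolynomial (Fin d) ℝ)

theorem val_gradMap (k : Fin d × Fin d) (x : E d) :
    val (gradMap v k) x = grad v k.1 k.2 x := rfl

theorem val_strainMap (k : Fin d × Fin d) (x : E d) :
    val (strainMap v k) x = strain v k.1 k.2 x := by
  simp only [strainMap, strain, LinearMap.smul_apply, LinearMap.add_apply, LinearMap.comp_apply,
    Pi.smul_apply, Pi.add_apply, val_smul, val_add, LinearMap.funLeft_apply, val_gradMap,
    Prod.fst_swap, Prod.snd_swap]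
  ring

theorem val_normalStrainMap (n : E d) (i : Fin d) (x : E d) :
    val (normalStrainMap n v i) x = strainN v n i x := by
  simp [normalStrainMap, strainN, LinearMap.sum_apply, val_strainMap, mul_comm]

variable {v}

theorem isRigidMotion_iff_strainMap_eq_zero : IsRigidMotion v ↔ strainMap v = 0 := by
  rw [strainMap, LinearMap.smul_apply, smul_eq_zero_iff_right (by norm_num)]
  simp [IsRigidMotion, gradMap, funext_iff, LinearMap.funLeft_apply]

theorem isRigidMotion_of_gradMap_eq_zero (hv : gradMap v = 0) : IsRigidMotion v := by
  rw [isRigidMotion_iff_strainMap_eq_zero]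
  simp [strainMap, hv]

end Strain

namespace Mesh

variable {d : ℕ} {ι I B : Type*}

theorem isThick_elem (M : Mesh d ι I B) (T : ι) : IsThick volume (M.elem T) := (M.isBody T).isThick

/-- The skeleton on which jumps are measured: the interior faces and the Dirichlet faces. -/
def skeleton (M : Mesh d ι I B) (Γ : Finset B) : I ⊕ Γ → Set (E d) :=
  Sum.elim M.iface fun F => M.bface F

theorem isThick_skeleton (M : Mesh d ι I B) (Γ : Finset B) (F : I ⊕ Γ) :
    IsThick (Measure.euclideanHausdorffMeasure (d - 1)) (M.skeleton Γ F) := by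
  cases F with
  | inl F => exact (M.facet_minus F).isThick (M.isBody _)
  | inr F => exact (M.facet_owner F).isThick (M.isBody _)

/-- The jump on interior faces and the trace on Dirichlet faces. -/
noncomputable def jumpMap (M : Mesh d ι I B) (Γ : Finset B) :
    Vect d ι →ₗ[ℝ] (I ⊕ Γ → Fin d → MvPolynomial (Fin d) ℝ) where
  toFun v := Sum.elim (fun F => v (M.minus F) - v (M.plus F)) fun F => v (M.owner F)
  map_add' u v := by
    funext F
    cases F <;> simp [add_sub_add_comm]
  map_smul' c v := by
    funext F
    cases F <;> simp [smul_sub]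

/-- The average of the normal strain on interior faces and the normal strain on Dirichlet faces. -/
noncomputable def fluxMap (M : Mesh d ι I B) (Γ : Finset B) :
    Vect d ι →ₗ[ℝ] (I ⊕ Γ → Fin d → MvPolynomial (Fin d) ℝ) :=
  LinearMap.pi fun
    | .inl F => (2⁻¹ : ℝ) • (normalStrainMap (M.inormal F) ∘ₗ LinearMap.proj (M.minus F) +
        normalStrainMap (M.inormal F) ∘ₗ LinearMap.proj (M.plus F))
    | .inr F => normalStrainMap (M.bnormal F) ∘ₗ LinearMap.proj (M.owner F)

section Traces

variable (M : Mesh d ι I B) (Γ : Finset B) (v : Vect d ι) (i : Fin d) (x : E d)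

theorem val_jumpMap_inl (F : I) : val (M.jumpMap Γ v (.inl F) i) x = M.jump v F i x :=
  val_sub _ _ _

theorem val_jumpMap_inr (F : Γ) :
    val (M.jumpMap Γ v (.inr F) i) x = val (v (M.owner F) i) x := rfl

theorem val_fluxMap_inl (F : I) : val (M.fluxMap Γ v (.inl F) i) x = M.avgStrainN v F i x := by
  simp only [fluxMap, avgStrainN, LinearMap.pi_apply, LinearMap.smul_apply,
    LinearMap.add_apply, LinearMap.comp_apply, LinearMap.proj_apply, Pi.smul_apply, Pi.add_apply,
    val_smul, val_add, val_normalStrainMap]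
  ring

theorem val_fluxMap_inr (F : Γ) :
    val (M.fluxMap Γ v (.inr F) i) x = strainN (v (M.owner F)) (M.bnormal F) i x :=
  val_normalStrainMap _ _ _ _

variable {v} in
theorem fluxMap_eq_zero (hv : ∀ T, strainMap (v T) = 0) : M.fluxMap Γ v = 0 := by
  funext F
  cases F <;> simp [fluxMap, normalStrainMap, hv]

end Traces

section Forms

variable [Fintype ι] (M : Mesh d ι I B)

/-- The form `(ε(u), ε(v))`. -/
noncomputable def strainForm : BilinForm ℝ (Vect d ι) :=
  (l2Form M.isThick_elem).comp (strainMap.compLeft ι) (strainMap.compLeft ι)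

/-- The form `(∇u, ∇v)`. -/
noncomputable def gradForm : BilinForm ℝ (Vect d ι) :=
  (l2Form M.isThick_elem).comp (gradMap.compLeft ι) (gradMap.compLeft ι)

theorem isPosSemidef_strainForm : M.strainForm.IsPosSemidef :=
  isPosSemidef_comp (isPosSemidef_l2Form _) _

theorem isPosSemidef_gradForm : M.gradForm.IsPosSemidef :=
  isPosSemidef_comp (isPosSemidef_l2Form _) _

variable {M} {v : Vect d ι}

theorem strainMap_eq_zero (hv : M.strainForm v v = 0) (T : ι) : strainMap (v T) = 0 :=
  congrFun (eq_zero_of_l2Form_self_eq_zero M.isThick_elem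
    (fun T => (M.isBody T).nonempty_interior) hv) T

theorem gradMap_eq_zero (hv : M.gradForm v v = 0) (T : ι) : gradMap (v T) = 0 :=
  congrFun (eq_zero_of_l2Form_self_eq_zero M.isThick_elem
    (fun T => (M.isBody T).nonempty_interior) hv) T

end Forms

section SkeletonForms

variable [Fintype I] (M : Mesh d ι I B) (Γ : Finset B)

/-- The jump terms `([u], [v])` on the skeleton. -/
noncomputable def jumpForm : BilinForm ℝ (Vect d ι) :=
  (l2Form (M.isThick_skeleton Γ)).comp (M.jumpMap Γ) (M.jumpMap Γ)

/-- The `L²` inner product of the averaged normal strains on the skeleton. -/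
noncomputable def fluxForm : BilinForm ℝ (Vect d ι) :=
  (l2Form (M.isThick_skeleton Γ)).comp (M.fluxMap Γ) (M.fluxMap Γ)

/-- The consistency terms `({ε(u) n}, [v])` on the skeleton. -/
noncomputable def consistencyForm : BilinForm ℝ (Vect d ι) :=
  (l2Form (M.isThick_skeleton Γ)).comp (M.fluxMap Γ) (M.jumpMap Γ)

theorem isPosSemidef_jumpForm : (M.jumpForm Γ).IsPosSemidef :=
  isPosSemidef_comp (isPosSemidef_l2Form _) _

theorem isPosSemidef_fluxForm : (M.fluxForm Γ).IsPosSemidef :=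
  isPosSemidef_comp (isPosSemidef_l2Form _) _

theorem two_mul_consistencyForm_le (v : Vect d ι) {s : ℝ} (hs : 0 < s) :
    2 * M.consistencyForm Γ v v ≤ s * M.fluxForm Γ v v + s⁻¹ * M.jumpForm Γ v v :=
  two_mul_apply_le_of_isPosSemidef (isPosSemidef_l2Form (M.isThick_skeleton Γ)) _ _ hs

theorem dForm_eq [Fintype ι] (γ : ℝ) (u v : Vect d ι) :
    M.dForm Γ γ u v = 2 * M.strainForm u v + γ / M.size * M.jumpForm Γ u v
      - 2 * M.consistencyForm Γ u v - 2 * M.consistencyForm Γ v u := by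
  simp only [dForm, faceInt, strainForm, jumpForm, consistencyForm,
    LinearMap.BilinForm.comp_apply, l2Form_apply, LinearMap.compLeft_apply, Function.comp_apply,
    Fintype.sum_sum_type, Fintype.sum_prod_type, skeleton, Sum.elim_inl, Sum.elim_inr,
    val_strainMap, val_jumpMap_inl, val_jumpMap_inr, val_fluxMap_inl, val_fluxMap_inr,
    ← Finset.sum_coe_sort Γ]
  ring

theorem normSq_eq [Fintype ι] (γ : ℝ) (v : Vect d ι) :
    M.normSq Γ γ v = M.gradForm v v + γ / M.size * M.jumpForm Γ v v := by
  simp only [normSq, faceInt, gradForm, jumpForm, LinearMap.BilinForm.comp_apply, l2Form_apply,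
    LinearMap.compLeft_apply, Function.comp_apply, Fintype.sum_sum_type, Fintype.sum_prod_type,
    skeleton, Sum.elim_inl, Sum.elim_inr, val_gradMap, val_jumpMap_inl, val_jumpMap_inr,
    ← Finset.sum_coe_sort Γ, ← Finset.mul_sum, sq]
  ring

variable {M Γ}

theorem eq_zero_of_isRigidMotion_of_jumpForm [Finite ι] (hΩ : IsPreconnected M.domain)
    (hΓ : Γ.Nonempty) {v : Vect d ι} (hv : ∀ T, IsRigidMotion (v T))
    (hJ : M.jumpForm Γ v v = 0) : v = 0 := by
  obtain ⟨F₀, hF₀⟩ := hΓ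
  have hzero := val_eq_zero_of_l2Form_self_eq_zero (M.isThick_skeleton Γ) hJ
  exact eq_zero_of_isRigidMotion hΩ hv
    (fun F x hx i => (M.val_jumpMap_inl Γ v i x F).symm.trans (hzero (.inl F) x hx i))
    (hzero (.inr ⟨F₀, hF₀⟩))

end SkeletonForms

section Coercivity

theorem size_pos_of_nonempty [Finite ι] {M : Mesh d ι I B} {Γ : Finset B}
    (hΓ : Γ.Nonempty) : 0 < M.size := by
  obtain ⟨F, -⟩ := hΓ
  have : NeZero d := ⟨(M.facet_owner F).dim_pos.ne'⟩
  exact M.size_pos (M.owner F)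

variable [Fintype ι] [Fintype I] {M : Mesh d ι I B} {Γ : Finset B}

theorem normSq_nonneg {γ : ℝ} (hγ : 0 ≤ γ) (v : Vect d ι) : 0 ≤ M.normSq Γ γ v := by
  rw [normSq_eq]
  have hsize : 0 ≤ M.size := Real.iSup_nonneg fun _ => Metric.diam_nonneg
  exact add_nonneg (M.isPosSemidef_gradForm.nonneg v)
    (mul_nonneg (div_nonneg hγ hsize) ((M.isPosSemidef_jumpForm Γ).nonneg v))

theorem eq_zero_of_normSq_eq_zero (hΩ : IsPreconnected M.domain) (hΓ : Γ.Nonempty) {γ : ℝ}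
    (hγ : 0 < γ) {v : Vect d ι} (hv : M.normSq Γ γ v = 0) : v = 0 := by
  have hβ : 0 < γ / M.size := div_pos hγ (size_pos_of_nonempty hΓ)
  rw [normSq_eq] at hv
  obtain ⟨hgrad, hjump⟩ := (add_eq_zero_iff_of_nonneg (M.isPosSemidef_gradForm.nonneg v)
    (mul_nonneg hβ.le ((M.isPosSemidef_jumpForm Γ).nonneg v))).1 hv
  exact eq_zero_of_isRigidMotion_of_jumpForm hΩ hΓ
    (fun T => isRigidMotion_of_gradMap_eq_zero (gradMap_eq_zero hgrad T))
    ((mul_eq_zero.1 hjump).resolve_left hβ.ne')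

theorem fluxForm_eq_zero {v : Vect d ι} (hv : M.strainForm v v = 0) : M.fluxForm Γ v v = 0 := by
  simp [fluxForm, M.fluxMap_eq_zero Γ (strainMap_eq_zero hv)]

theorem eq_zero_of_strainForm_of_jumpForm (hΩ : IsPreconnected M.domain) (hΓ : Γ.Nonempty)
    {v : Vect d ι} (hS : M.strainForm v v = 0) (hJ : M.jumpForm Γ v v = 0) : v = 0 :=
  eq_zero_of_isRigidMotion_of_jumpForm hΩ hΓ
    (fun T => isRigidMotion_iff_strainMap_eq_zero.2 (strainMap_eq_zero hS T)) hJ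

theorem exists_forall_coercive (hΩ : IsPreconnected M.domain) (hΓ : Γ.Nonempty)
    (V : Submodule ℝ (Vect d ι)) [FiniteDimensional ℝ V] :
    ∃ γ₀ : ℝ, 0 < γ₀ ∧ ∀ γ ≥ γ₀, M.Coercive Γ γ V := by
  have hsize : 0 < M.size := size_pos_of_nonempty hΓ
  obtain ⟨β₀, hβ₀, h⟩ := exists_forall_penalty_coercive
    (isPosSemidef_comp M.isPosSemidef_strainForm V.subtype)
    (isPosSemidef_comp (M.isPosSemidef_jumpForm Γ) V.subtype)
    (isPosSemidef_comp M.isPosSemidef_gradForm V.subtype)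
    (isPosSemidef_comp (M.isPosSemidef_fluxForm Γ) V.subtype)
    (X := (M.consistencyForm Γ).comp V.subtype V.subtype)
    (fun v s hs => M.two_mul_consistencyForm_le Γ v hs)
    (fun v hv => fluxForm_eq_zero hv)
    fun v hS hJ => by
      simp [eq_zero_of_strainForm_of_jumpForm hΩ hΓ (v := v) hS hJ]
  refine ⟨β₀ * M.size, by positivity, fun γ hγ => ?_⟩
  obtain ⟨κ, hκ, hκV⟩ := h (γ / M.size) ((le_div_iff₀ hsize).2 hγ)
  refine ⟨κ, hκ, fun v hv => ?_⟩
  rw [normSq_eq, dForm_eq]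
  refine (hκV ⟨v, hv⟩).trans_eq ?_
  simp only [LinearMap.BilinForm.comp_apply, Submodule.subtype_apply]
  ring

end Coercivity

end Mesh

end Biot

namespace Biot

open Set

/-! ### Linear differential equations with constant coefficients -/

section LinearODE

variable {F : Type*} [NormedAddCommGroup F] [NormedSpace ℝ F] [CompleteSpace F]

theorem exp_smul_apply_exp_smul_neg (A : F →L[ℝ] F) (t : ℝ) (x : F) :
    NormedSpace.exp (t • A) (NormedSpace.exp (t • (-A)) x) = x := by
  have hcomm : Commute (t • A) (t • (-A)) := by simp [Commute, SemiconjBy]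
  have : NormedAlgebra ℚ (F →L[ℝ] F) := NormedAlgebra.restrictScalars ℚ ℝ _
  have hmul : NormedSpace.exp (t • A) * NormedSpace.exp (t • (-A)) = 1 := by
    rw [← NormedSpace.exp_add_of_commute hcomm]
    simp
  exact congrArg (fun B : F →L[ℝ] F => B x) hmul

theorem continuous_exp_smul (A : F →L[ℝ] F) : Continuous fun t : ℝ => NormedSpace.exp (t • A) :=
  continuous_iff_continuousAt.2 fun t => (hasDerivAt_exp_smul_const A t).continuousAt

theorem exists_hasDerivAt_apply_add (A : F →L[ℝ] F) {b : ℝ → F} (hb : ContinuousOn b (Ici 0))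
    (y₀ : F) : ∃ y : ℝ → F, Continuous y ∧ y 0 = y₀ ∧
      ∀ t > 0, HasDerivAt y (A (y t) + b t) t := by
  let c : ℝ → F := fun s => NormedSpace.exp (s • (-A)) (b (max s 0))
  have hc : Continuous c := (continuous_exp_smul (-A)).clm_apply
    (hb.comp_continuous (by fun_prop) fun t => le_max_right t 0)
  let y : ℝ → F := fun t => NormedSpace.exp (t • A) (y₀ + ∫ s in (0 : ℝ)..t, c s)
  have hy : ∀ t, HasDerivAt y (A (y t) + b (max t 0)) t := fun t => by
    have h := (hasDerivAt_exp_smul_const' A t).clm_apply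
      ((hc.integral_hasStrictDerivAt 0 t).hasDerivAt.const_add y₀)
    rwa [exp_smul_apply_exp_smul_neg] at h
  refine ⟨y, continuous_iff_continuousAt.2 fun t => (hy t).continuousAt, by simp [y],
    fun t ht => ?_⟩
  simpa only [max_eq_left (le_of_lt ht)] using hy t

theorem eq_zero_of_hasDerivAt_apply (A : F →L[ℝ] F) {y : ℝ → F} (hy : ContinuousOn y (Ici 0))
    (h0 : y 0 = 0) (hder : ∀ t > 0, HasDerivAt y (A (y t)) t) : ∀ t ≥ 0, y t = 0 := by
  intro t ht
  have hconst := intervalIntegral.integral_eq_sub_of_hasDerivAt_of_le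
    (f := fun s : ℝ => NormedSpace.exp (s • (-A)) (y s)) (f' := fun _ => 0) ht
    ((continuous_exp_smul (-A)).continuousOn.clm_apply (hy.mono Icc_subset_Ici_self))
    (fun s hs => by
      simpa using (hasDerivAt_exp_smul_const (-A) s).clm_apply (hder s hs.1)) (by simp)
  simp only [intervalIntegral.integral_zero, h0, map_zero, sub_zero] at hconst
  rw [← exp_smul_apply_exp_smul_neg A t (y t), ← hconst, map_zero]

end LinearODE

section Curves

variable {X Y : Type*} [AddCommGroup X] [Module ℝ X] [AddCommGroup Y] [Module ℝ Y]

/-- A curve that is continuous for `t ≥ 0`, in the sense of all its linear coordinates. -/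
def ContinuousCurve (y : ℝ → X) : Prop :=
  ∀ l : Module.Dual ℝ X, ContinuousOn (fun t => l (y t)) (Ici 0)

/-- The curve `y` has the derivative `y'` at time `t`, in the sense of all its linear
coordinates. -/
def HasCurveDerivAt (y : ℝ → X) (y' : X) (t : ℝ) : Prop :=
  ∀ l : Module.Dual ℝ X, HasDerivAt (fun s => l (y s)) (l y') t

namespace ContinuousCurve

theorem sub {y z : ℝ → X} (hy : ContinuousCurve y) (hz : ContinuousCurve z) :
    ContinuousCurve fun t => y t - z t := fun l => by
  simpa only [map_sub, Pi.sub_def] using (hy l).sub (hz l)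

theorem map {y : ℝ → X} (hy : ContinuousCurve y) (f : X →ₗ[ℝ] Y) :
    ContinuousCurve fun t => f (y t) := fun l => hy (l ∘ₗ f)

theorem prodMk {y : ℝ → X} {z : ℝ → Y} (hy : ContinuousCurve y) (hz : ContinuousCurve z) :
    ContinuousCurve fun t => (y t, z t) := fun l => by
  simpa only [Pi.add_def, ← map_add, LinearMap.comp_apply, LinearMap.inl_apply,
    LinearMap.inr_apply, Prod.mk_add_mk, add_zero, zero_add] using
    (hy (l ∘ₗ LinearMap.inl ℝ X Y)).add (hz (l ∘ₗ LinearMap.inr ℝ X Y))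

theorem of_dual [FiniteDimensional ℝ X] {y : ℝ → Module.Dual ℝ X}
    (hy : ∀ x, ContinuousOn (fun t => y t x) (Ici 0)) : ContinuousCurve y := fun l => by
  obtain ⟨x, rfl⟩ := (Module.evalEquiv ℝ X).surjective l
  exact hy x

theorem apply_zero_eq {y z : ℝ → X} (hy : ContinuousCurve y) (hz : ContinuousCurve z)
    (h : ∀ t > 0, y t = z t) : y 0 = z 0 := by
  refine sub_eq_zero.1 ((Module.forall_dual_apply_eq_zero_iff ℝ _).1 fun l => ?_)
  have hcont := ((hy.sub hz) l 0 self_mem_Ici).mono Ioi_subset_Ici_self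
  refine tendsto_nhds_unique hcont.tendsto (tendsto_const_nhds.congr' ?_)
  filter_upwards [self_mem_nhdsWithin] with t ht
  rw [h t ht, sub_self, map_zero]

end ContinuousCurve

theorem HasCurveDerivAt.of_dual [FiniteDimensional ℝ X] {y : ℝ → Module.Dual ℝ X}
    {y' : Module.Dual ℝ X} {t : ℝ} (h : ∀ x, HasDerivAt (fun s => y s x) (y' x) t) :
    HasCurveDerivAt y y' t := fun l => by
  obtain ⟨x, rfl⟩ := (Module.evalEquiv ℝ X).surjective l
  exact h x

theorem exists_hasCurveDerivAt_apply_add [FiniteDimensional ℝ X] (A : X →ₗ[ℝ] X) {b : ℝ → X}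
    (hb : ContinuousCurve b) (y₀ : X) :
    ∃ y : ℝ → X, ContinuousCurve y ∧ y 0 = y₀ ∧
      ∀ t > 0, HasCurveDerivAt y (A (y t) + b t) t := by
  let e := (Module.finBasis ℝ X).equivFun
  obtain ⟨z, hz, hz0, hder⟩ := exists_hasDerivAt_apply_add
    (LinearMap.toContinuousLinearMap (e.toLinearMap ∘ₗ A ∘ₗ e.symm.toLinearMap))
    (b := fun t => e (b t))
    (continuousOn_pi.2 fun i => hb (LinearMap.proj i ∘ₗ e.toLinearMap)) (e y₀)
  refine ⟨fun t => e.symm (z t), fun l => ?_, by simp [hz0], fun t ht l => ?_⟩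
  · exact ((LinearMap.toContinuousLinearMap (l ∘ₗ e.symm.toLinearMap)).continuous.comp
      hz).continuousOn
  · simpa [Function.comp_def] using (LinearMap.toContinuousLinearMap
      (l ∘ₗ e.symm.toLinearMap)).hasFDerivAt.comp_hasDerivAt t (hder t ht)

theorem eq_of_hasCurveDerivAt_apply_add [FiniteDimensional ℝ X] (A : X →ₗ[ℝ] X) {b y z : ℝ → X}
    (hy : ContinuousCurve y) (hz : ContinuousCurve z) (h0 : y 0 = z 0)
    (hyd : ∀ t > 0, HasCurveDerivAt y (A (y t) + b t) t)
    (hzd : ∀ t > 0, HasCurveDerivAt z (A (z t) + b t) t) : ∀ t ≥ 0, y t = z t := by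
  let e := (Module.finBasis ℝ X).equivFun
  have hzero := eq_zero_of_hasDerivAt_apply
    (LinearMap.toContinuousLinearMap (e.toLinearMap ∘ₗ A ∘ₗ e.symm.toLinearMap))
    (y := fun t => e (y t - z t))
    (continuousOn_pi.2 fun i => (hy.sub hz) (LinearMap.proj i ∘ₗ e.toLinearMap))
    (by simp [h0]) fun t ht => hasDerivAt_pi.2 fun i => by
      simp only [LinearMap.coe_toContinuousLinearMap', LinearMap.comp_apply,
        LinearEquiv.coe_coe, LinearEquiv.symm_apply_apply, map_sub, Pi.sub_apply]
      simpa [Pi.sub_def] using (hyd t ht (LinearMap.proj i ∘ₗ e.toLinearMap)).sub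
        (hzd t ht (LinearMap.proj i ∘ₗ e.toLinearMap))
  exact fun t ht => sub_eq_zero.1 (e.map_eq_zero_iff.1 (hzero t ht))

end Curves

end Biot

namespace Biot

open LinearMap (BilinForm inl inr)
open Module (Dual)

/-! ### The abstract Biot system -/

section PosDef

variable {X : Type*} [AddCommGroup X] [Module ℝ X] {P : BilinForm ℝ X}

theorem nondegenerate_of_posDef (hP : P.toQuadraticMap.PosDef) : P.Nondegenerate :=
  ⟨fun x h => hP.anisotropic x (h x), fun x h => hP.anisotropic x (h x)⟩

theorem eq_zero_of_forall_apply_eq_zero (hP : P.toQuadraticMap.PosDef) {Y : Type*} {f : Y → X}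
    (hf : Function.Surjective f) {x : X} (h : ∀ y, P x (f y) = 0) : x = 0 :=
  (nondegenerate_of_posDef hP).1 x (hf.forall.2 h)

theorem eq_toDual_symm_iff [FiniteDimensional ℝ X] (hP : P.Nondegenerate) {x : X} {l : Dual ℝ X} :
    x = (P.toDual hP).symm l ↔ P x = l :=
  (P.toDual hP).eq_symm_apply

end PosDef

/-- The data of the Biot system in abstract form: the inner product of the pressure space, the
forms of the Darcy and elasticity equations, the two divergence operators, the storage coefficient
and the coupling coefficient. -/
structure System (Q W V : Type*) [AddCommGroup Q] [Module ℝ Q] [AddCommGroup W] [Module ℝ W]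
    [AddCommGroup V] [Module ℝ V] where
  massForm : BilinForm ℝ Q
  darcyForm : BilinForm ℝ W
  elasticForm : BilinForm ℝ V
  divW : W →ₗ[ℝ] Q
  divV : V →ₗ[ℝ] Q
  cs : ℝ
  alpha : ℝ
  isSymm_massForm : massForm.IsSymm
  posDef_massForm : massForm.toQuadraticMap.PosDef
  posDef_darcyForm : darcyForm.toQuadraticMap.PosDef
  posDef_elasticForm : elasticForm.toQuadraticMap.PosDef
  divW_surjective : Function.Surjective divW
  divV_surjective : Function.Surjective divV
  cs_nonneg : 0 ≤ cs

namespace System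

variable {Q W V : Type*} [AddCommGroup Q] [Module ℝ Q] [AddCommGroup W] [Module ℝ W]
  [AddCommGroup V] [Module ℝ V] (S : System Q W V)

/-- The fluid content `c_s p + α div u` as a functional on the pressure space. -/
def content : Q × V →ₗ[ℝ] Dual ℝ Q :=
  (S.cs • S.massForm).coprod (S.alpha • (S.massForm ∘ₗ S.divV))

theorem content_apply (p q : Q) (u : V) : S.content (p, u) q =
    S.cs * S.massForm p q + S.alpha * S.massForm (S.divV u) q := rfl

theorem eq_zero_of_homogeneous {σ : ℝ} (hσ : 0 < σ) {p : Q} {w : W} {u : V}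
    (mass : ∀ q, σ * S.content (p, u) q + S.massForm (S.divW w) q = 0)
    (darcy : ∀ z, S.darcyForm w z - S.massForm p (S.divW z) = 0)
    (elasticity : ∀ v, S.elasticForm u v - S.alpha * S.massForm p (S.divV v) = 0) :
    p = 0 ∧ w = 0 ∧ u = 0 := by
  have energy : σ * (S.cs * S.massForm p p) + S.darcyForm w w + σ * S.elasticForm u u = 0 := by
    have hmass := mass p
    rw [content_apply, S.isSymm_massForm.eq (S.divV u) p,
      S.isSymm_massForm.eq (S.divW w) p] at hmass
    linear_combination hmass + darcy w + σ * elasticity u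
  have hp : 0 ≤ σ * (S.cs * S.massForm p p) :=
    mul_nonneg hσ.le (mul_nonneg S.cs_nonneg (S.posDef_massForm.nonneg p))
  have hw : 0 ≤ S.darcyForm w w := S.posDef_darcyForm.nonneg w
  have hu : 0 ≤ σ * S.elasticForm u u := mul_nonneg hσ.le (S.posDef_elasticForm.nonneg u)
  have hw0 : S.darcyForm w w = 0 := by linarith
  have hu0 : σ * S.elasticForm u u = 0 := by linarith
  obtain rfl : w = 0 := S.posDef_darcyForm.anisotropic w hw0
  obtain rfl : u = 0 :=
    S.posDef_elasticForm.anisotropic u ((mul_eq_zero.1 hu0).resolve_left hσ.ne')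
  refine ⟨eq_zero_of_forall_apply_eq_zero S.posDef_massForm S.divW_surjective fun z => ?_, rfl, rfl⟩
  simpa using darcy z

/-- `(p, w, u)` solves the semi-discrete equations for positive times. -/
structure IsSolution (S : System Q W V) (f : ℝ → Dual ℝ Q) (g : ℝ → Dual ℝ W) (r : ℝ → Dual ℝ V)
    (p : ℝ → Q) (w : ℝ → W) (u : ℝ → V) : Prop where
  continuous_p : ContinuousCurve p
  continuous_w : ContinuousCurve w
  continuous_u : ContinuousCurve u
  mass : ∀ t > 0, ∀ q, HasDerivAt (fun s => S.content (p s, u s) q)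
    (f t q - S.massForm (S.divW (w t)) q) t
  darcy : ∀ t > 0, ∀ z, S.darcyForm (w t) z - S.massForm (p t) (S.divW z) = g t z
  elasticity : ∀ t > 0, ∀ v,
    S.elasticForm (u t) v - S.alpha * S.massForm (p t) (S.divV v) = r t v

section Elimination

/-- The velocity that solves the Darcy equation for the right hand side `g` and the pressure `p`. -/
noncomputable def velocity [FiniteDimensional ℝ W] : Dual ℝ W × Q →ₗ[ℝ] W :=
  (S.darcyForm.toDual (nondegenerate_of_posDef S.posDef_darcyForm)).symm.toLinearMap ∘ₗ
    LinearMap.id.coprod (S.massForm.compl₂ S.divW)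

theorem eq_velocity_iff [FiniteDimensional ℝ W] {g : Dual ℝ W} {p : Q} {w : W} :
    w = S.velocity (g, p) ↔ ∀ z, S.darcyForm w z - S.massForm p (S.divW z) = g z :=
  (eq_toDual_symm_iff (nondegenerate_of_posDef S.posDef_darcyForm)).trans <|
    LinearMap.ext_iff.trans <| forall_congr' fun _ =>
    sub_eq_iff_eq_add.symm

variable [FiniteDimensional ℝ V]

/-- The displacement that solves the elasticity equation for the right hand side `r` and the
pressure `p`. -/
noncomputable def displacement : Dual ℝ V × Q →ₗ[ℝ] V :=
  (S.elasticForm.toDual (nondegenerate_of_posDef S.posDef_elasticForm)).symm.toLinearMap ∘ₗ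
    LinearMap.id.coprod (S.alpha • S.massForm.compl₂ S.divV)

theorem eq_displacement_iff {r : Dual ℝ V} {p : Q} {u : V} : u = S.displacement (r, p) ↔
    ∀ v, S.elasticForm u v - S.alpha * S.massForm p (S.divV v) = r v :=
  (eq_toDual_symm_iff (nondegenerate_of_posDef S.posDef_elasticForm)).trans <|
    LinearMap.ext_iff.trans <| forall_congr' fun _ =>
    sub_eq_iff_eq_add.symm

/-- The fluid content due to a pressure, including that of the displacement which the pressure
causes, as a bilinear form on the pressure space. -/
noncomputable def storageForm : BilinForm ℝ Q :=
  S.content ∘ₗ LinearMap.id.prod (S.displacement ∘ₗ inr ℝ (Dual ℝ V) Q)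

theorem content_displacement (r : Dual ℝ V) (p : Q) : S.content (p, S.displacement (r, p)) =
    S.storageForm p + S.content (0, S.displacement (r, 0)) := by
  have hsplit : (p, S.displacement (r, p)) =
      (p, S.displacement (0, p)) + (0, S.displacement (r, 0)) := by
    rw [Prod.mk_add_mk, ← map_add, Prod.mk_add_mk, zero_add, add_zero]
  rw [hsplit, map_add]
  rfl

theorem posDef_storageForm (h : S.alpha ≠ 0 ∨ 0 < S.cs) : S.storageForm.toQuadraticMap.PosDef := by
  intro p hp
  let u := S.displacement (0, p)
  have hu : ∀ v, S.elasticForm u v = S.alpha * S.massForm p (S.divV v) := fun v =>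
    sub_eq_zero.1 (S.eq_displacement_iff.1 rfl v)
  have hform : S.storageForm p p = S.cs * S.massForm p p + S.elasticForm u u := by
    rw [hu, ← S.isSymm_massForm.eq (S.divV u) p]
    rfl
  have hm : 0 < S.massForm p p := S.posDef_massForm p hp
  have hnonneg : 0 ≤ S.elasticForm u u := S.posDef_elasticForm.nonneg u
  rw [LinearMap.BilinMap.toQuadraticMap_apply, hform]
  rcases h with halpha | hcs
  · have hu0 : u ≠ 0 := fun hu0 => hp <|
      eq_zero_of_forall_apply_eq_zero S.posDef_massForm S.divV_surjective fun v => by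
        simpa [hu0, halpha] using hu v
    exact add_pos_of_nonneg_of_pos (mul_nonneg S.cs_nonneg hm.le) (S.posDef_elasticForm u hu0)
  · exact add_pos_of_pos_of_nonneg (mul_pos hcs hm) hnonneg

variable [FiniteDimensional ℝ Q] (h : S.alpha ≠ 0 ∨ 0 < S.cs)

/-- The pressure for which the fluid content is `η`, when the displacement solves the elasticity
equation with the right hand side `r`. -/
noncomputable def pressure : Dual ℝ V × Dual ℝ Q →ₗ[ℝ] Q :=
  (S.storageForm.toDual (nondegenerate_of_posDef (S.posDef_storageForm h))).symm.toLinearMap ∘ₗ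
    (-(S.content ∘ₗ inr ℝ Q V ∘ₗ S.displacement ∘ₗ inl ℝ (Dual ℝ V) Q)).coprod LinearMap.id

theorem eq_pressure_iff {r : Dual ℝ V} {η : Dual ℝ Q} {p : Q} :
    p = S.pressure h (r, η) ↔ S.content (p, S.displacement (r, p)) = η := by
  rw [content_displacement, ← eq_sub_iff_add_eq, sub_eq_neg_add]
  exact eq_toDual_symm_iff (nondegenerate_of_posDef (S.posDef_storageForm h))

end Elimination

variable [FiniteDimensional ℝ Q] [FiniteDimensional ℝ V]
  {f : ℝ → Dual ℝ Q} {g : ℝ → Dual ℝ W} {r : ℝ → Dual ℝ V} {p p' : ℝ → Q} {w w' : ℝ → W}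
  {u u' : ℝ → V}

theorem IsSolution.eq_pressure {S : System Q W V} (h : S.alpha ≠ 0 ∨ 0 < S.cs)
    (hsol : S.IsSolution f g r p w u) {t : ℝ} (ht : 0 < t) :
    p t = S.pressure h (r t, S.content (p t, u t)) := by
  rw [S.eq_pressure_iff, ← S.eq_displacement_iff.2 (hsol.elasticity t ht)]

variable [FiniteDimensional ℝ W]

/-- The operator `A` of the equation `η' = A η + b` for the fluid content `η`. -/
noncomputable def generator (h : S.alpha ≠ 0 ∨ 0 < S.cs) : Dual ℝ Q →ₗ[ℝ] Dual ℝ Q :=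
  -(S.massForm ∘ₗ S.divW ∘ₗ S.velocity ∘ₗ inr ℝ (Dual ℝ W) Q ∘ₗ S.pressure h ∘ₗ
    inr ℝ (Dual ℝ V) (Dual ℝ Q))

/-- The inhomogeneity `b` of the equation `η' = A η + b` for the fluid content `η`. -/
noncomputable def source (h : S.alpha ≠ 0 ∨ 0 < S.cs) (f : ℝ → Dual ℝ Q) (g : ℝ → Dual ℝ W)
    (r : ℝ → Dual ℝ V) (t : ℝ) : Dual ℝ Q :=
  f t - S.massForm (S.divW (S.velocity (g t, S.pressure h (r t, 0))))

theorem generator_add_source (h : S.alpha ≠ 0 ∨ 0 < S.cs) (t : ℝ) (η : Dual ℝ Q) :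
    S.generator h η + S.source h f g r t =
      f t - S.massForm (S.divW (S.velocity (g t, S.pressure h (r t, η)))) := by
  have hsplit : (g t, S.pressure h (r t, η)) =
      (0, S.pressure h (0, η)) + (g t, S.pressure h (r t, 0)) := by
    rw [Prod.mk_add_mk, ← map_add, Prod.mk_add_mk, zero_add, zero_add, add_zero]
  rw [hsplit, map_add, map_add, map_add, sub_add_eq_sub_sub, sub_right_comm, source,
    sub_eq_neg_add (f t - _)]
  rfl

theorem continuousCurve_source (h : S.alpha ≠ 0 ∨ 0 < S.cs) (hf : ContinuousCurve f)
    (hg : ContinuousCurve g) (hr : ContinuousCurve r) : ContinuousCurve (S.source h f g r) :=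
  hf.sub ((hg.prodMk (hr.map (S.pressure h ∘ₗ inl ℝ (Dual ℝ V) (Dual ℝ Q)))).map
    (S.massForm ∘ₗ S.divW ∘ₗ S.velocity))

variable {S}

theorem IsSolution.hasCurveDerivAt_content (h : S.alpha ≠ 0 ∨ 0 < S.cs)
    (hsol : S.IsSolution f g r p w u) {t : ℝ} (ht : 0 < t) :
    HasCurveDerivAt (fun s => S.content (p s, u s))
      (S.generator h (S.content (p t, u t)) + S.source h f g r t) t := by
  rw [generator_add_source, ← hsol.eq_pressure h ht, ← S.eq_velocity_iff.2 (hsol.darcy t ht)]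
  exact .of_dual (hsol.mass t ht)

theorem IsSolution.unique (h : S.alpha ≠ 0 ∨ 0 < S.cs) (hsol : S.IsSolution f g r p w u)
    (hsol' : S.IsSolution f g r p' w' u') (hp₀ : p' 0 = p 0) (hu₀ : u' 0 = u 0) :
    ∀ t ≥ 0, p' t = p t ∧ w' t = w t ∧ u' t = u t := by
  have hcontent : ∀ t ≥ 0, S.content (p' t, u' t) = S.content (p t, u t) :=
    eq_of_hasCurveDerivAt_apply_add (S.generator h)
      ((hsol'.continuous_p.prodMk hsol'.continuous_u).map S.content)
      ((hsol.continuous_p.prodMk hsol.continuous_u).map S.content) (by rw [hp₀, hu₀])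
      (fun _ => hsol'.hasCurveDerivAt_content h) fun _ => hsol.hasCurveDerivAt_content h
  have hp : ∀ t > 0, p' t = p t := fun t ht => by
    rw [hsol'.eq_pressure h ht, hcontent t (le_of_lt ht), ← hsol.eq_pressure h ht]
  have hw : ∀ t > 0, w' t = w t := fun t ht => by
    rw [S.eq_velocity_iff.2 (hsol'.darcy t ht), hp t ht,
      ← S.eq_velocity_iff.2 (hsol.darcy t ht)]
  have hu : ∀ t > 0, u' t = u t := fun t ht => by
    rw [S.eq_displacement_iff.2 (hsol'.elasticity t ht), hp t ht,
      ← S.eq_displacement_iff.2 (hsol.elasticity t ht)]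
  intro t ht
  rcases (show (0 : ℝ) ≤ t from ht).eq_or_lt with rfl | ht
  · exact ⟨hp₀, hsol'.continuous_w.apply_zero_eq hsol.continuous_w hw, hu₀⟩
  · exact ⟨hp t ht, hw t ht, hu t ht⟩

variable (S)

theorem isSolution_of_hasCurveDerivAt (h : S.alpha ≠ 0 ∨ 0 < S.cs) (hg : ContinuousCurve g)
    (hr : ContinuousCurve r) {η : ℝ → Dual ℝ Q} (hη : ContinuousCurve η)
    (hder : ∀ t > 0, HasCurveDerivAt η (S.generator h (η t) + S.source h f g r t) t)
    (hp : ∀ t, p t = S.pressure h (r t, η t)) :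
    S.IsSolution f g r p (fun t => S.velocity (g t, p t))
      (fun t => S.displacement (r t, p t)) := by
  have hpc : ContinuousCurve p := by
    rw [funext hp]
    exact (hr.prodMk hη).map (S.pressure h)
  refine ⟨hpc, (hg.prodMk hpc).map S.velocity, (hr.prodMk hpc).map S.displacement,
    fun t ht q => ?_, fun t _ => S.eq_velocity_iff.1 rfl, fun t _ => S.eq_displacement_iff.1 rfl⟩
  have hq := hder t ht (Dual.eval ℝ Q q)
  rw [generator_add_source, ← hp] at hq
  simp only [(S.eq_pressure_iff h).1 (hp _)]
  exact hq

theorem exists_isSolution (h : S.alpha ≠ 0 ∨ 0 < S.cs) (hf : ContinuousCurve f)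
    (hg : ContinuousCurve g) (hr : ContinuousCurve r) {p₀ : Q} {u₀ : V}
    (h₀ : ∀ v, S.elasticForm u₀ v - S.alpha * S.massForm p₀ (S.divV v) = r 0 v) :
    ∃ p w u, S.IsSolution f g r p w u ∧ p 0 = p₀ ∧ u 0 = u₀ := by
  have hu₀ : u₀ = S.displacement (r 0, p₀) := S.eq_displacement_iff.2 h₀
  obtain ⟨η, hη, hη₀, hder⟩ := exists_hasCurveDerivAt_apply_add (S.generator h)
    (S.continuousCurve_source h hf hg hr) (S.content (p₀, u₀))
  have hp₀ : S.pressure h (r 0, η 0) = p₀ := by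
    rw [eq_comm, S.eq_pressure_iff, hη₀, hu₀]
  refine ⟨_, _, _, S.isSolution_of_hasCurveDerivAt h hg hr hη hder fun _ => rfl, hp₀, ?_⟩
  rw [hp₀, hu₀]

end System

end Biot

namespace Biot

open MeasureTheory
open LinearMap (BilinForm)

namespace Mesh

/-! ### The discrete Biot system -/

section Divergence

variable {d : ℕ} {ι : Type*} {W : Submodule ℝ (Vect d ι)} {Q : Submodule ℝ (Scal d ι)}

/-- The divergence as a map between discrete spaces. -/
noncomputable def divRestrict (h : W.map (divB d ι) = Q) : W →ₗ[ℝ] Q :=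
  (divB d ι).restrict fun _ hw => h ▸ Submodule.mem_map_of_mem hw

theorem divRestrict_surjective (h : W.map (divB d ι) = Q) :
    Function.Surjective (divRestrict h) := by
  rintro ⟨q, hq⟩
  obtain ⟨w, hw, rfl⟩ := h.ge hq
  exact ⟨⟨w, hw⟩, rfl⟩

end Divergence

variable {d : ℕ} {ι I B : Type*}

section Inner

variable [Fintype ι] (M : Mesh d ι I B)

theorem posDef_l2Form {κ : Type*} [Fintype κ] :
    (l2Form M.isThick_elem :
      BilinForm ℝ (ι → κ → MvPolynomial (Fin d) ℝ)).toQuadraticMap.PosDef :=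
  QuadraticMap.posDef_iff_nonneg.2 ⟨(isPosSemidef_l2Form M.isThick_elem).nonneg,
    fun _ => eq_zero_of_l2Form_self_eq_zero M.isThick_elem fun T => (M.isBody T).nonempty_interior⟩

/-- The `L²` inner product of piecewise polynomial functions, which are regarded as vector fields
with a single component. -/
noncomputable def massForm : BilinForm ℝ (Scal d ι) :=
  (l2Form M.isThick_elem).comp
    ((LinearEquiv.funUnique Unit ℝ _).symm.toLinearMap.compLeft ι)
    ((LinearEquiv.funUnique Unit ℝ _).symm.toLinearMap.compLeft ι)

theorem innerS_eq (p q : Scal d ι) : M.innerS p q = M.massForm p q := by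
  simp only [innerS, massForm, LinearMap.BilinForm.comp_apply, l2Form_apply, Fintype.sum_unique]
  rfl

theorem isPosSemidef_massForm : M.massForm.IsPosSemidef :=
  isPosSemidef_comp (isPosSemidef_l2Form M.isThick_elem) _

theorem posDef_massForm : M.massForm.toQuadraticMap.PosDef := fun _ hp =>
  M.posDef_l2Form _ fun h => hp <| funext fun T => congrFun (congrFun h T) ()

/-- The form `(A w, z)`. -/
noncomputable def matrixForm (A : Matrix (Fin d) (Fin d) ℝ) : BilinForm ℝ (Vect d ι) :=
  l2Form M.isThick_elem ∘ₗ
    (LinearMap.pi fun i => ∑ j, A i j • LinearMap.proj j : _ →ₗ[ℝ] _).compLeft ι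

theorem innerV_eq (A : Matrix (Fin d) (Fin d) ℝ) (w z : Vect d ι) :
    M.innerV A w z = M.matrixForm A w z := by
  simp [innerV, matrixForm, l2Form_apply, LinearMap.sum_apply]

theorem posDef_matrixForm {A : Matrix (Fin d) (Fin d) ℝ} (hA : A.PosDef) :
    (M.matrixForm A).toQuadraticMap.PosDef := by
  have hquad : ∀ (w : Fin d → MvPolynomial (Fin d) ℝ) x,
      ∑ i, (∑ j, A i j * val (w j) x) * val (w i) x =
        star (fun i => val (w i) x) ⬝ᵥ A.mulVec fun i => val (w i) x := fun w x => by
    simp [dotProduct, Matrix.mulVec, mul_comm]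
  have hnonneg : ∀ (w : Fin d → MvPolynomial (Fin d) ℝ) x,
      0 ≤ ∑ i, (∑ j, A i j * val (w j) x) * val (w i) x := fun w x => by
    rw [hquad]
    exact hA.posSemidef.dotProduct_mulVec_nonneg _
  refine QuadraticMap.posDef_iff_nonneg.2 ⟨fun w => ?_,
    fun w hw => funext fun T => funext fun i => ?_⟩
  · exact (Finset.sum_nonneg fun T _ => integral_nonneg (hnonneg (w T))).trans_eq
      (M.innerV_eq A w w)
  refine eq_zero_of_forall_val_eq_zero (M.isBody T).nonempty_interior fun x hx => ?_
  have hint := (Finset.sum_eq_zero_iff_of_nonneg fun T _ => integral_nonneg (hnonneg (w T))).1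
    ((M.innerV_eq A w w).trans hw) T (Finset.mem_univ T)
  have hpoint := (M.isThick_elem T).eq_zero_of_setIntegral_eq_zero (by fun_prop) (hnonneg (w T))
    hint x hx
  rw [hquad] at hpoint
  by_contra hne
  exact (hA.dotProduct_mulVec_pos fun h => hne (congrFun h i)).ne' hpoint

end Inner

section Elasticity

variable [Fintype ι] [Fintype I] {M : Mesh d ι I B} {Γ : Finset B} {γ : ℝ} {c : Coefficients d}

/-- The form `a_h`. -/
noncomputable def elasticityForm (M : Mesh d ι I B) (Γ : Finset B) (γ : ℝ) (c : Coefficients d) :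
    BilinForm ℝ (Vect d ι) :=
  c.mu • ((2 : ℝ) • M.strainForm + (γ / M.size) • M.jumpForm Γ - (2 : ℝ) • M.consistencyForm Γ
    - (2 : ℝ) • (M.consistencyForm Γ).flip) + c.lam • M.massForm.comp (divB d ι) (divB d ι)

theorem aForm_eq (u v : Vect d ι) : M.aForm Γ γ c u v = M.elasticityForm Γ γ c u v := by
  simp [aForm, elasticityForm, dForm_eq, innerS_eq]

theorem Coercive.elasticityForm_pos (hΩ : IsPreconnected M.domain) (hΓ : Γ.Nonempty) (hγ : 0 < γ)
    {V : Submodule ℝ (Vect d ι)} (hV : M.Coercive Γ γ V) (hmu : 0 < c.mu) (hlam : 0 ≤ c.lam)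
    {v : Vect d ι} (hv : v ∈ V) (hv0 : v ≠ 0) : 0 < M.elasticityForm Γ γ c v v := by
  obtain ⟨κ, hκ, hcoercive⟩ := hV
  have hnorm : 0 < M.normSq Γ γ v := (M.normSq_nonneg hγ.le v).lt_of_ne' fun h =>
    hv0 (eq_zero_of_normSq_eq_zero hΩ hΓ hγ h)
  have hd : 0 < M.dForm Γ γ v v := (mul_pos hκ hnorm).trans_le (hcoercive v hv)
  rw [← aForm_eq, aForm, innerS_eq]
  exact add_pos_of_pos_of_nonneg (mul_pos hmu hd)
    (mul_nonneg hlam (M.isPosSemidef_massForm.nonneg _))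

end Elasticity

variable [Fintype ι] [Fintype I]

/-- The hypotheses on mesh, discrete spaces and coefficients under which the discrete system is
uniquely solvable. -/
structure IsStable (M : Mesh d ι I B) (Γ : Finset B) (γ : ℝ) (c : Coefficients d)
    (Q : Submodule ℝ (Scal d ι)) (W V : Submodule ℝ (Vect d ι)) : Prop where
  isPreconnected : IsPreconnected M.domain
  nonempty : Γ.Nonempty
  map_divW : W.map (divB d ι) = Q
  map_divV : V.map (divB d ι) = Q
  penalty_pos : 0 < γ
  coercive : M.Coercive Γ γ V
  mu_pos : 0 < c.mu
  lam_nonneg : 0 ≤ c.lam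
  cs_nonneg : 0 ≤ c.cs
  posDef : c.K.PosDef

namespace IsStable

variable {M : Mesh d ι I B} {Γ : Finset B} {γ : ℝ} {c : Coefficients d}
  {Q : Submodule ℝ (Scal d ι)} {W V : Submodule ℝ (Vect d ι)} (h : M.IsStable Γ γ c Q W V)

include h

/-- The discrete Biot system in abstract form. -/
noncomputable def system : System Q W V where
  massForm := M.massForm.restrict Q
  darcyForm := (M.matrixForm c.K⁻¹).restrict W
  elasticForm := (M.elasticityForm Γ γ c).restrict V
  divW := divRestrict h.map_divW
  divV := divRestrict h.map_divV
  cs := c.cs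
  alpha := c.alpha
  isSymm_massForm := ⟨fun p q => M.isPosSemidef_massForm.eq p q⟩
  posDef_massForm := fun q hq => M.posDef_massForm q (by simpa using hq)
  posDef_darcyForm := fun w hw => M.posDef_matrixForm h.posDef.inv w (by simpa using hw)
  posDef_elasticForm := fun v hv => h.coercive.elasticityForm_pos h.isPreconnected h.nonempty
    h.penalty_pos h.mu_pos h.lam_nonneg v.2 (by simpa using hv)
  divW_surjective := divRestrict_surjective h.map_divW
  divV_surjective := divRestrict_surjective h.map_divV
  cs_nonneg := h.cs_nonneg

theorem innerS_content (p : Q) (u : V) (q : Q) :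
    M.innerS (c.cs • (p : Scal d ι) + c.alpha • divB d ι u) q = h.system.content (p, u) q := by
  rw [innerS_eq, map_add, map_smul, map_smul]
  rfl

theorem innerS_div (w : W) (q : Q) :
    M.innerS (divB d ι w) q = h.system.massForm (h.system.divW w) q :=
  M.innerS_eq _ _

theorem darcy_eq (w : W) (p : Q) (z : W) : M.innerV c.K⁻¹ w z - M.innerS p (divB d ι z) =
    h.system.darcyForm w z - h.system.massForm p (h.system.divW z) := by
  rw [innerV_eq, innerS_eq]
  rfl

theorem elasticity_eq (u : V) (p : Q) (v : V) :
    M.aForm Γ γ c u v - c.alpha * M.innerS p (divB d ι v) =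
      h.system.elasticForm u v - h.system.alpha * h.system.massForm p (h.system.divV v) := by
  rw [aForm_eq, innerS_eq]
  rfl

theorem isSemidiscreteSolution_iff {f : ℝ → Module.Dual ℝ Q} {g : ℝ → Module.Dual ℝ W}
    {r : ℝ → Module.Dual ℝ V} {p : ℝ → Q} {w : ℝ → W} {u : ℝ → V} :
    M.IsSemidiscreteSolution Γ γ c Q W V f g r p w u ↔ h.system.IsSolution f g r p w u where
  mp s := ⟨s.continuous_p, s.continuous_w, s.continuous_u,
    by simpa only [h.innerS_content, h.innerS_div] using s.mass,
    by simpa only [h.darcy_eq] using s.darcy,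
    by simpa only [h.elasticity_eq] using s.elasticity⟩
  mpr s := ⟨s.continuous_p, s.continuous_w, s.continuous_u,
    by simpa only [h.innerS_content, h.innerS_div] using s.mass,
    by simpa only [h.darcy_eq] using s.darcy,
    by simpa only [h.elasticity_eq] using s.elasticity⟩

theorem isHomogeneousSolution_iff {σ : ℝ} (hσ : 0 < σ) {p : Q} {w : W} {u : V} :
    M.IsHomogeneousSolution Γ γ c Q W V σ p w u ↔ p = 0 ∧ w = 0 ∧ u = 0 := by
  constructor
  · rintro ⟨mass, darcy, elasticity⟩
    refine h.system.eq_zero_of_homogeneous hσ (fun q => ?_) (fun z => ?_) fun v => ?_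
    · rw [← h.innerS_content, ← h.innerS_div, ← mass q q.2, innerS_eq, innerS_eq, innerS_eq,
        map_smul]
      rfl
    · exact (h.darcy_eq w p z).symm.trans (darcy z z.2)
    · exact (h.elasticity_eq u p v).symm.trans (elasticity v v.2)
  · rintro ⟨rfl, rfl, rfl⟩
    constructor <;> simp [innerS_eq, innerV_eq, aForm_eq]

theorem isWellPosed [FiniteDimensional ℝ Q] [FiniteDimensional ℝ W] [FiniteDimensional ℝ V]
    (hc : c.alpha ≠ 0 ∨ 0 < c.cs) : M.IsWellPosed Γ γ c Q W V := by
  intro f g r hf hg hr p₀ u₀ h₀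
  obtain ⟨p, w, u, hsol, hp₀, hu₀⟩ := h.system.exists_isSolution hc (.of_dual hf) (.of_dual hg)
    (.of_dual fun v => (hr v).continuousOn) fun v => (h.elasticity_eq u₀ p₀ v).symm.trans (h₀ v)
  refine ⟨p, w, u, ⟨h.isSemidiscreteSolution_iff.2 hsol, hp₀, hu₀⟩,
    fun p' w' u' hsol' hp' hu' => ?_⟩
  exact hsol.unique hc (h.isSemidiscreteSolution_iff.1 hsol') (hp'.trans hp₀.symm)
    (hu'.trans hu₀.symm)

end IsStable

end Mesh

end Biot

theorem mainTheorem4_general {d : ℕ} {ι I B : Type*} [Fintype ι] [Fintype I]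
    (M : Biot.Mesh d ι I B) (hΩ : IsPreconnected M.domain)
    (Γ : Finset B) (hΓ : Γ.Nonempty)
    (W V : Submodule ℝ (Biot.Vect d ι)) [FiniteDimensional ℝ W] [FiniteDimensional ℝ V]
    (Q : Submodule ℝ (Biot.Scal d ι))
    (hdivW : W.map (Biot.divB d ι) = Q) (hdivV : V.map (Biot.divB d ι) = Q) :
    (∃ γ₀ : ℝ, 0 < γ₀ ∧ ∀ γ ≥ γ₀, M.Coercive Γ γ V) ∧
    ∀ γ : ℝ, 0 < γ → M.Coercive Γ γ V →
      ∀ c : Biot.Coefficients d, 0 < c.mu → 0 ≤ c.lam → 0 ≤ c.cs → c.K.PosDef →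
        (∀ σ : ℝ, 0 < σ → ∀ (p : Q) (w : W) (u : V),
          M.IsHomogeneousSolution Γ γ c Q W V σ p w u ↔ p = 0 ∧ w = 0 ∧ u = 0) ∧
        ((c.alpha ≠ 0 ∨ 0 < c.cs) → M.IsWellPosed Γ γ c Q W V) := by
  have hQ : FiniteDimensional ℝ Q :=
    Module.Finite.of_surjective _ (Biot.Mesh.divRestrict_surjective hdivV)
  refine ⟨M.exists_forall_coercive hΩ hΓ V, fun γ hγ hcoercive c hmu hlam hcs hK => ?_⟩
  have hstable : M.IsStable Γ γ c Q W V :=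
    ⟨hΩ, hΓ, hdivW, hdivV, hγ, hcoercive, hmu, hlam, hcs, hK⟩
  exact ⟨fun σ hσ p w u => hstable.isHomogeneousSolution_iff hσ, hstable.isWellPosed⟩

theorem mainTheorem4 {d : ℕ} (hd : 2 ≤ d) {ι I B : Type*} [Fintype ι] [Fintype I] [Fintype B]
    (M : Biot.Mesh d ι I B) (hΩ : IsConnected M.domain)
    -- the faces where the normal velocity, respectively the displacement, is prescribed
    (ΓpN ΓuD : Finset B) (hΓ : ΓuD.Nonempty)
    -- a divergence conforming space, with the two boundary conditions, and the pressure space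
    (X : Submodule ℝ (Biot.Vect d ι)) [FiniteDimensional ℝ X] (hX : ∀ v ∈ X, M.IsHdiv v)
    (W V : Submodule ℝ (Biot.Vect d ι))
    (hW : W = X ⊓ M.normalZero ΓpN) (hV : V = X ⊓ M.normalZero ΓuD)
    (Q : Submodule ℝ (Biot.Scal d ι))
    (hdivW : W.map (Biot.divB d ι) = Q) (hdivV : V.map (Biot.divB d ι) = Q) :
    (∃ γ₀ : ℝ, 0 < γ₀ ∧ ∀ γ ≥ γ₀, M.Coercive ΓuD γ V) ∧
    ∀ γ : ℝ, 0 < γ → M.Coercive ΓuD γ V →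
      ∀ c : Biot.Coefficients d, 0 < c.mu → 0 ≤ c.lam → 0 ≤ c.cs → c.K.PosDef →
        (∀ σ : ℝ, 0 < σ → ∀ (p : Q) (w : W) (u : V),
          M.IsHomogeneousSolution ΓuD γ c Q W V σ p w u ↔ p = 0 ∧ w = 0 ∧ u = 0) ∧
        ((c.alpha ≠ 0 ∨ 0 < c.cs) → M.IsWellPosed ΓuD γ c Q W V) := by
  subst hW hV
  exact mainTheorem4_general M hΩ.isPreconnected ΓuD hΓ _ _ Q hdivW hdivV
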